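/- Let $p$ be a prime, let $\mathbb{C}_p$ be the completion of an algebraic closure $\overline{\mathbb{Q}}_p$ with $|p|_p=p^{-1}$, and let $\log_p:\mathbb{C}_p^\times\to\mathbb{C}_p$ be the $p$-adic logarithm normalized by $\log_p p=0$. Let $d\ge 1$, and for a commutative ring $A$ write $L_d(A)=A[t_1^{\pm1},\dots,t_d^{\pm1}]$ and $t^\delta=t_1^{\delta_1}\cdots t_d^{\delta_d}$ for $\delta\in\mathbb{Z}^d$. Let $K$ be a number field with ring of integers $\mathcal{O}_K$, and let $f\in M_s(L_d(\mathcal{O}_K))$. For $g\in L_d(\mathcal{O}_K)$ put $$N_{K/\mathbb{Q}}(g)=\prod_{\tau:K\hookrightarrow\overline{\mathbb{Q}}}\tau(g)\in L_d(\mathbb{Z}),$$ where $\tau$ is applied to the coefficients. Let $$X_f=\bigl(L_d(\mathcal{O}_K)^s/fL_d(\mathcal{O}_K)^s\bigr)^\wedge$$ be the Pontryagin dual of the discrete group $L_d(\mathcal{O}_K)^s/fL_d(\mathcal{O}_K)^s$, with the $\mathbb{Z}^d$-action induced by the action $\delta\cdot x=t^\delta x$ of $\mathbb{Z}^d$ on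 $L_d(\mathcal{O}_K)^s$. Assume that $N_{K/\mathbb{Q}}(\det f)$ does not vanish at any point of the $p$-adic torus $$T_p^d=\{(z_1,\dots,z_d)\in\mathbb{C}_p^d : |z_1|_p=\dots=|z_d|_p=1\}.$$ Then the $p$-adic entropy $$h_p(X_f)=\lim_{\substack{n\to\infty\\(n,p)=1}}\frac{1}{[\mathbb{Z}^d:(n\mathbb{Z})^d]}\log_p\bigl|\mathrm{Fix}_{(n\mathbb{Z})^d}(X_f)\bigr|$$ exists (in particular, the sets $\mathrm{Fix}_{(n\mathbb{Z})^d}(X_f)$ of points fixed by $(n\mathbb{Z})^d$ are finite for all $n\ge1$ with $(n,p)=1$), the $p$-adic Mahler measure $$m_p(N_{K/\mathbb{Q}}(\det f))=\lim_{\substack{N\to\infty\\(N,p)=1}}\frac{1}{N^d}\sum_{\zeta\in\mu_N^d}\log_p\bigl(N_{K/\mathbb{Q}}(\det f)(\zeta)\bigr),\qquad \mu_N=\{z\in\mathbb{C}_p: z^N=1\},$$ exists, and $$h_p(X_f)=m_p(N_{K/\mathbb{Q}}(\det f)).$$ -/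

import Mathlib

open Filter Topology

noncomputable section

namespace PadicEntropy

/-! ### Laurent polynomials -/

/-- The ring `A[t₁^{±1}, …, t_d^{±1}]` of Laurent polynomials in `d` variables over `A`,
that is, the group ring of `ℤ^d` over `A`. -/
abbrev Laurent (A : Type*) [CommRing A] (d : ℕ) : Type _ :=
  AddMonoidAlgebra A (Fin d → ℤ)

namespace Laurent

/-- Apply a ring homomorphism to all coefficients of a Laurent polynomial. -/
abbrev mapCoeff {A B : Type*} [CommRing A] [CommRing B] (d : ℕ) (φ : A →+* B) :
    Laurent A d →+* Laurent B d :=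
  AddMonoidAlgebra.mapRingHom (Fin d → ℤ) φ

/-- The value `f(z) = ∑ a_ν z₁^{ν₁} ⋯ z_d^{ν_d}` of a Laurent polynomial over a field at a point
`z` (used only at points all of whose coordinates are nonzero). -/
def eval {F : Type*} [Field F] {d : ℕ} (z : Fin d → F) (f : Laurent F d) : F :=
  f.coeff.sum fun ν a => a * ∏ i, z i ^ ν i

/-- The monomial `t^δ = t₁^{δ₁} ⋯ t_d^{δ_d}`. -/
def monomial (A : Type*) [CommRing A] {d : ℕ} (δ : Fin d → ℤ) : Laurent A d :=
  AddMonoidAlgebra.single δ 1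

theorem monomial_zero (A : Type*) [CommRing A] {d : ℕ} :
    monomial A (0 : Fin d → ℤ) = 1 := rfl

theorem monomial_add (A : Type*) [CommRing A] {d : ℕ} (δ ε : Fin d → ℤ) :
    monomial A (δ + ε) = monomial A δ * monomial A ε := by
  simp [monomial, AddMonoidAlgebra.single_mul_single]

end Laurent

/-! ### The norm of a Laurent polynomial over the ring of integers of a number field -/

open NumberField

section Norm

variable (K : Type*) [Field K] [NumberField K] {d : ℕ}

/-- The product `∏_τ τ(f)` over all embeddings `τ` of `K` into an algebraic closure of `ℚ`, where
`τ` is applied to the coefficients of `f`. -/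
def embeddingProd (f : Laurent (𝓞 K) d) : Laurent (AlgebraicClosure ℚ) d :=
  ∏ τ : K →+* AlgebraicClosure ℚ,
    Laurent.mapCoeff d (τ.comp (algebraMap (𝓞 K) K)) f

theorem isIntegral_coeff_embeddingProd (f : Laurent (𝓞 K) d) (ν : Fin d → ℤ) :
    IsIntegral ℤ ((embeddingProd K f).coeff ν) := by
  let φ : (K →+* AlgebraicClosure ℚ) → (𝓞 K →+* integralClosure ℤ (AlgebraicClosure ℚ)) :=
    fun τ => RingHom.codRestrict (τ.comp (algebraMap (𝓞 K) K))
      (integralClosure ℤ (AlgebraicClosure ℚ)) fun x =>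
        (RingOfIntegers.isIntegral_coe x).map τ.toIntAlgHom
  have h : embeddingProd K f =
      Laurent.mapCoeff d (integralClosure ℤ (AlgebraicClosure ℚ)).val.toRingHom
        (∏ τ, Laurent.mapCoeff d (φ τ) f) := by
    rw [map_prod]
    refine Finset.prod_congr rfl fun τ _ => ?_
    ext ν
    simp only [AddMonoidAlgebra.coeff_mapRingHom]
    rfl
  rw [h, AddMonoidAlgebra.coeff_mapRingHom]
  exact ((∏ τ, Laurent.mapCoeff d (φ τ) f).coeff ν).2

theorem fixed_coeff_embeddingProd (f : Laurent (𝓞 K) d) (ν : Fin d → ℤ)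
    (σ : AlgebraicClosure ℚ ≃+* AlgebraicClosure ℚ) :
    σ ((embeddingProd K f).coeff ν) = (embeddingProd K f).coeff ν := by
  have h : Laurent.mapCoeff d (σ : AlgebraicClosure ℚ →+* AlgebraicClosure ℚ)
      (embeddingProd K f) = embeddingProd K f := by
    unfold embeddingProd
    rw [map_prod]
    refine Fintype.prod_bijective (fun τ : K →+* AlgebraicClosure ℚ =>
        (σ : AlgebraicClosure ℚ →+* AlgebraicClosure ℚ).comp τ)
      ⟨fun τ₁ τ₂ h => ?_, fun τ => ⟨(σ.symm : AlgebraicClosure ℚ →+* AlgebraicClosure ℚ).comp τ, ?_⟩⟩ _ _ fun τ => ?_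
    · ext x
      exact σ.injective (DFunLike.congr_fun h x)
    · ext x
      simp
    · ext ν
      simp
  have h' := congrArg (fun g => g.coeff ν) h
  simpa using h'

/-- The product over all embeddings has coefficients in `ℤ`. -/
theorem exists_laurentNorm (f : Laurent (𝓞 K) d) :
    ∃ g : Laurent ℤ d,
      Laurent.mapCoeff d (Int.castRingHom (AlgebraicClosure ℚ)) g = embeddingProd K f := by
  have h : ∀ ν, ∃ n : ℤ, (n : AlgebraicClosure ℚ) = (embeddingProd K f).coeff ν := by
    intro ν
    let _ : Algebra ℚ (AlgebraicClosure ℚ) := AlgebraicClosure.instAlgebra ℚ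
    have : IsGalois ℚ (AlgebraicClosure ℚ) := IsAlgClosure.isGalois ℚ (AlgebraicClosure ℚ)
    obtain ⟨q, hq⟩ := (InfiniteGalois.mem_range_algebraMap_iff_fixed (k := ℚ)
      ((embeddingProd K f).coeff ν)).2 fun σ =>
        fixed_coeff_embeddingProd K f ν σ.toRingEquiv
    have hi := isIntegral_coeff_embeddingProd K f ν
    rw [← hq, isIntegral_algebraMap_iff (algebraMap ℚ (AlgebraicClosure ℚ)).injective] at hi
    obtain ⟨n, hn⟩ := IsIntegrallyClosed.isIntegral_iff.1 hi
    exact ⟨n, by rw [← hq, ← hn]; simp⟩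
  choose c hc using h
  refine ⟨.ofCoeff (Finsupp.onFinset (embeddingProd K f).coeff.support c fun ν hν => ?_), ?_⟩
  · rw [Finsupp.mem_support_iff, ← hc]
    exact_mod_cast hν
  · ext ν
    simp [hc]

/-- The norm `N_{K/ℚ}(f) = ∏_τ τ(f)`, as a Laurent polynomial with integer coefficients
(it is unique, since `ℤ` embeds into the algebraic closure of `ℚ`). -/
def laurentNorm (f : Laurent (𝓞 K) d) : Laurent ℤ d :=
  (exists_laurentNorm K f).choose

theorem laurentNorm_spec (f : Laurent (𝓞 K) d) :
    Laurent.mapCoeff d (Int.castRingHom (AlgebraicClosure ℚ)) (laurentNorm K f) =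
      ∏ τ : K →+* AlgebraicClosure ℚ,
        Laurent.mapCoeff d (τ.comp (algebraMap (𝓞 K) K)) f :=
  (exists_laurentNorm K f).choose_spec

end Norm

/-! ### The `p`-adic logarithm -/

section Log

variable (p : ℕ) [Fact p.Prime]

/-- The series `log (1 + x) = ∑_{k ≥ 1} (-1)^{k-1} x^k / k`, convergent for `|x|_p < 1`. -/
def logSeries (x : ℂ_[p]) : ℂ_[p] :=
  ∑' k : ℕ, (-1) ^ k * x ^ (k + 1) / ((k + 1 : ℕ) : ℂ_[p])

open Classical in
/-- The `p`-adic logarithm `log_p : ℂ_p^× → ℂ_p` normalised by `log_p p = 0`. For every `z ≠ 0`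
there are `N ≥ 1` and `a ∈ ℤ` such that `u = z^N p^{-a}` satisfies `|u - 1|_p < 1`, and then
`log_p z = (1 / N) log u` with `log u` given by the logarithm series; this does not depend on the
choice of `(N, a)`. (At `z = 0`, where no such pair exists, the value is set to `0`.) -/
def padicLog (z : ℂ_[p]) : ℂ_[p] :=
  if h : ∃ Na : ℕ × ℤ, 0 < Na.1 ∧ ‖z ^ Na.1 * (p : ℂ_[p]) ^ (-Na.2) - 1‖ < 1 then
    (h.choose.1 : ℂ_[p])⁻¹ *
      logSeries p (z ^ h.choose.1 * (p : ℂ_[p]) ^ (-h.choose.2) - 1)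
  else 0

end Log

/-! ### `p`-adic entropy and `p`-adic Mahler measure -/

/-- The filter for limits `n → ∞` along the integers `n` prime to `p`. -/
def atTopCoprime (p : ℕ) : Filter ℕ := atTop ⊓ 𝓟 {n | n.Coprime p}

/-- The subgroup `(nℤ)^d` of `ℤ^d`. -/
def multiples (d n : ℕ) : AddSubgroup (Fin d → ℤ) :=
  AddSubgroup.pi Set.univ fun _ => AddSubgroup.zmultiples (n : ℤ)

/-- `Fix_{(nℤ)^d}(X)`, the set of points of `X` fixed by `(nℤ)^d`. -/
def fixedSet (d n : ℕ) (X : Type*) [AddAction (Fin d → ℤ) X] : Set X :=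
  AddAction.fixedPoints (multiples d n) X

/-- The `p`-adic entropy of the `ℤ^d`-action on `X` exists and equals `h`: the sets
`Fix_{(nℤ)^d}(X)`, `(n, p) = 1`, are finite and nonempty (so that the logarithms make sense), and
`[ℤ^d : (nℤ)^d]⁻¹ log_p |Fix_{(nℤ)^d}(X)|` tends to `h` as `n → ∞` with `(n, p) = 1`. -/
def HasPadicEntropy (p : ℕ) [Fact p.Prime] (d : ℕ) (X : Type*) [AddAction (Fin d → ℤ) X]
    (h : ℂ_[p]) : Prop :=
  (∀ n : ℕ, n.Coprime p → (fixedSet d n X).Finite ∧ (fixedSet d n X).Nonempty) ∧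
  Tendsto (fun n : ℕ => ((multiples d n).index : ℂ_[p])⁻¹ *
    padicLog p ((fixedSet d n X).ncard : ℂ_[p])) (atTopCoprime p) (𝓝 h)

/-- The finite set `μ_N^d ⊆ ℂ_p^d`, for `N ≥ 1`. -/
def rootsOfUnityPow (p : ℕ) [Fact p.Prime] (d N : ℕ) : Finset (Fin d → ℂ_[p]) :=
  Fintype.piFinset fun _ => Polynomial.nthRootsFinset N (1 : ℂ_[p])

/-- The `p`-adic Mahler measure of `f` exists and equals `m`: `f` has no zero in `μ_N^d` for
`(N, p) = 1` (so that the logarithms make sense), and `N^{-d} ∑_{ζ ∈ μ_N^d} log_p f(ζ)` tends to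
`m` as `N → ∞` with `(N, p) = 1`. -/
def HasPadicMahlerMeasure (p : ℕ) [Fact p.Prime] {d : ℕ} (f : Laurent ℂ_[p] d)
    (m : ℂ_[p]) : Prop :=
  (∀ N : ℕ, N.Coprime p → ∀ ζ ∈ rootsOfUnityPow p d N, f.eval ζ ≠ 0) ∧
  Tendsto (fun N : ℕ => ((N : ℂ_[p]) ^ d)⁻¹ *
    ∑ ζ ∈ rootsOfUnityPow p d N, padicLog p (f.eval ζ)) (atTopCoprime p) (𝓝 m)

/-- The `p`-adic `d`-torus `T_p^d = {z ∈ ℂ_p^d : |z₁|_p = ⋯ = |z_d|_p = 1}`. -/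
def padicTorus (p : ℕ) [Fact p.Prime] (d : ℕ) : Set (Fin d → ℂ_[p]) :=
  {z | ∀ i, ‖z i‖ = 1}

/-! ### The dynamical system `X_f` -/

section System

variable {A : Type*} [CommRing A] {d s : ℕ}

/-- The cokernel `L_d(A)^s / f L_d(A)^s` of a square matrix `f` over `L_d(A)`. -/
def Coker (f : Matrix (Fin s) (Fin s) (Laurent A d)) : Type _ :=
  (Fin s → Laurent A d) ⧸ LinearMap.range f.mulVecLin

variable (f : Matrix (Fin s) (Fin s) (Laurent A d))

instance : AddCommGroup (Coker f) :=
  inferInstanceAs (AddCommGroup ((Fin s → Laurent A d) ⧸ LinearMap.range f.mulVecLin))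

instance : Module (Laurent A d) (Coker f) :=
  inferInstanceAs (Module (Laurent A d) ((Fin s → Laurent A d) ⧸ LinearMap.range f.mulVecLin))

/-- The cokernel carries the discrete topology. -/
instance : TopologicalSpace (Coker f) := ⊥

instance : DiscreteTopology (Coker f) := ⟨rfl⟩

/-- The Pontryagin dual `X_f = (L_d(A)^s / f L_d(A)^s)^∧`. -/
abbrev DualSystem : Type _ := PontryaginDual (Multiplicative (Coker f))

/-- The endomorphism `x ↦ t^δ x` of the discrete group `L_d(A)^s / f L_d(A)^s`; it is induced by
the shift `∑ a_ν t^ν ↦ ∑ a_ν t^{ν + δ}` in each of the `s` coordinates. -/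
def shift (δ : Fin d → ℤ) : Multiplicative (Coker f) →ₜ* Multiplicative (Coker f) where
  toFun x := Multiplicative.ofAdd (Laurent.monomial A δ • x.toAdd)
  map_one' := by simp
  map_mul' x y := by simp
  continuous_toFun := continuous_of_discreteTopology

/-- The action of `ℤ^d` on `X_f` dual to the shift action: `(δ · χ)(x) = χ(t^δ x)`. -/
instance : AddAction (Fin d → ℤ) (DualSystem f) where
  vadd δ χ := PontryaginDual.map (shift f δ) χ
  zero_vadd χ := by
    refine PontryaginDual.ext fun x => ?_
    change χ (Multiplicative.ofAdd (Laurent.monomial A (0 : Fin d → ℤ) • x.toAdd)) = χ x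
    rw [Laurent.monomial_zero, one_smul, ofAdd_toAdd]
  add_vadd δ ε χ := by
    refine PontryaginDual.ext fun x => ?_
    change χ (Multiplicative.ofAdd (Laurent.monomial A (δ + ε) • x.toAdd)) =
      χ (Multiplicative.ofAdd (Laurent.monomial A ε • (Laurent.monomial A δ • x.toAdd)))
    rw [smul_smul, ← Laurent.monomial_add, add_comm]

end System

end PadicEntropy

end

open Filter Topology

noncomputable section

namespace PadicEntropy

/-! ### The `p`-adic logarithm: convergence, additivity, and elements on which it is defined. -/

section Log

variable (p : ℕ) [Fact p.Prime]

/-! For `n` prime to `p`, the `n`-th terms of the two limits are equal, so it suffices that the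
Mahler measure exists.

Equality of the terms. A character of the cokernel of `f` is fixed by `(nℤ)^d` exactly when it
factors through the cokernel of the reduction of `f` over `𝓞_K[(ℤ/n)^d]` (`range_pullbackChar`).
This ring is free over `ℤ` of rank `[K:ℚ] n^d`, so the fixed points number `|Norm(det f mod n)|`
(`natAbs_norm_det_eq_card`). Its homomorphisms to `ℂ_p` given by an embedding of `K` and a point of
`μ_n^d` are as many as its rank, so the norm is the product of the values of `N_{K/ℚ}(det f)` on
`μ_n^d` (`norm_reduction_eq_prod`). The sign is lost because `log_p(-1) = 0`.

Convergence. A Laurent polynomial without zeros on the torus has a unique coefficient of maximal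
norm (`exists_dominant_laurent_coeff`), so it is `c t^ν (1 + G)` with the coefficients of `G`
bounded by some `r < 1`. At roots of unity the monomial has logarithm zero, and `log(1 + G)` expands
in powers of `G`, whose averages over `μ_N^d` tend to their constant coefficients; ultrametric
bounds uniform in `N` allow passing to the limit termwise.

Additivity of `log_p` is needed only on products of integers, roots of unity and principal units;
`HasLog` covers these. -/

theorem inv_le_norm_natCast {n : ℕ} (hn : n ≠ 0) : (n : ℝ)⁻¹ ≤ ‖(n : ℂ_[p])‖ := by
  have h1 : ‖(n : ℂ_[p])‖ = ‖(n : ℚ_[p])‖ := by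
    rw [← PadicComplex.norm_extends' p (n : ℚ_[p])]
    congr 1
    simp
  rw [h1, Padic.norm_eq_zpow_neg_valuation (by exact_mod_cast hn), Padic.valuation_natCast,
    zpow_neg, zpow_natCast]
  have hp : (0 : ℝ) < p := by exact_mod_cast (Fact.out : p.Prime).pos
  apply inv_anti₀ (by positivity)
  exact_mod_cast Nat.le_of_dvd (Nat.pos_of_ne_zero hn) pow_padicValNat_dvd

theorem norm_natCast_of_coprime {n : ℕ} (hn : n.Coprime p) : ‖(n : ℂ_[p])‖ = 1 := by
  have h1 : ‖(n : ℂ_[p])‖ = ‖(n : ℚ_[p])‖ := by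
    rw [← PadicComplex.norm_extends' p (n : ℚ_[p])]
    congr 1
    simp
  rw [h1, Padic.norm_natCast_eq_one_iff]
  exact hn.symm

theorem norm_prime : ‖(p : ℂ_[p])‖ = (p : ℝ)⁻¹ := by
  have h1 : ‖(p : ℂ_[p])‖ = ‖(p : ℚ_[p])‖ := by
    rw [← PadicComplex.norm_extends' p (p : ℚ_[p])]
    congr 1
    simp
  rw [h1, Padic.norm_p]

theorem norm_prime_lt_one : ‖(p : ℂ_[p])‖ < 1 := by
  rw [norm_prime]
  exact inv_lt_one_of_one_lt₀ (by exact_mod_cast (Fact.out : p.Prime).one_lt)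

theorem prime_ne_zero : (p : ℂ_[p]) ≠ 0 := by
  exact_mod_cast (Fact.out : p.Prime).ne_zero

variable {p}

/-- The power of `p` dividing `k + 1` is at most `k + 1`, so the denominator costs at most that
factor. All dominating series below come from this. -/
theorem norm_div_succ_le {x : ℂ_[p]} {r : ℝ} (hx : ‖x‖ ≤ r) (k : ℕ) :
    ‖x / ((k + 1 : ℕ) : ℂ_[p])‖ ≤ ((k + 1 : ℕ) : ℝ) * r := by
  have h := inv_le_norm_natCast p (n := k + 1) (by omega)
  have h0 : (0 : ℝ) < ((k + 1 : ℕ) : ℝ)⁻¹ := by positivity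
  rw [norm_div, div_eq_mul_inv, mul_comm]
  refine mul_le_mul ?_ hx (by positivity) (by positivity)
  simpa using inv_anti₀ h0 h

theorem norm_mul_pow_div_le {c x : ℂ_[p]} (hc : ‖c‖ ≤ 1) {r : ℝ} (hx : ‖x‖ ≤ r) (k : ℕ) :
    ‖c * x ^ (k + 1) / ((k + 1 : ℕ) : ℂ_[p])‖ ≤ ((k + 1 : ℕ) : ℝ) * r ^ (k + 1) := by
  refine norm_div_succ_le ?_ k
  rw [norm_mul, norm_pow]
  calc ‖c‖ * ‖x‖ ^ (k + 1) ≤ 1 * r ^ (k + 1) := by gcongr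
    _ = _ := one_mul _

theorem summable_succ_mul_pow_succ {r : ℝ} (h0 : 0 ≤ r) (h1 : r < 1) :
    Summable fun k : ℕ => ((k + 1 : ℕ) : ℝ) * r ^ (k + 1) := by
  have h := summable_pow_mul_geometric_of_norm_lt_one (R := ℝ) 1
    (r := r) (by rwa [Real.norm_of_nonneg h0])
  simpa using (summable_nat_add_iff 1).2 h

theorem tendsto_prime_pow : Tendsto (fun n : ℕ => (p : ℂ_[p]) ^ n) atTop (𝓝 0) :=
  tendsto_pow_atTop_nhds_zero_of_norm_lt_one (norm_prime_lt_one p)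

/-- Since `p^n - 1` tends to `-1`, the limit is the binomial coefficient of `-1` over `k`. In the
induction, Pascal's rule flips the sign, up to `choose (p^n) (k+1)`, which is divisible by `p^n` up
to the fixed factor `k + 1`. -/
theorem tendsto_choose (k : ℕ) :
    Tendsto (fun n : ℕ => (((p ^ n - 1).choose k : ℕ) : ℂ_[p])) atTop (𝓝 ((-1) ^ k)) := by
  induction k with
  | zero => simp
  | succ k ih =>
    have hrec : ∀ n : ℕ, (((p ^ n - 1).choose (k + 1) : ℕ) : ℂ_[p]) =
        (p : ℂ_[p]) ^ n * ((p ^ n - 1).choose k : ℕ) / ((k + 1 : ℕ) : ℂ_[p]) -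
          ((p ^ n - 1).choose k : ℕ) := by
      intro n
      obtain ⟨m, hm⟩ : ∃ m, p ^ n = m + 1 :=
        Nat.exists_eq_succ_of_ne_zero (pow_ne_zero _ (Fact.out : p.Prime).ne_zero)
      have hm' : (p : ℂ_[p]) ^ n = ((m + 1 : ℕ) : ℂ_[p]) := by exact_mod_cast hm
      have hk : ((k + 1 : ℕ) : ℂ_[p]) ≠ 0 := by exact_mod_cast Nat.succ_ne_zero k
      rw [hm', hm, Nat.add_sub_cancel, ← Nat.cast_mul,
        show (m + 1) * m.choose k = (m + 1).choose (k + 1) * (k + 1) from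
          Nat.add_one_mul_choose_eq m k, Nat.cast_mul, mul_div_cancel_right₀ _ hk,
        Nat.choose_succ_succ]
      push_cast
      ring
    simp_rw [hrec]
    have := ((tendsto_prime_pow (p := p)).mul ih).div_const ((k + 1 : ℕ) : ℂ_[p]) |>.sub ih
    simpa [pow_succ] using this

/-- The binomial theorem. The finite sum is written as a series to be compared termwise with
`logSeries`. -/
theorem one_add_pow_sub_one_div (x : ℂ_[p]) (n : ℕ) :
    ((1 + x) ^ p ^ n - 1) / (p : ℂ_[p]) ^ n =
      ∑' k : ℕ, ((p ^ n - 1).choose k : ℕ) * x ^ (k + 1) / ((k + 1 : ℕ) : ℂ_[p]) := by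
  obtain ⟨m, hm⟩ : ∃ m, p ^ n = m + 1 :=
    Nat.exists_eq_succ_of_ne_zero (pow_ne_zero _ (Fact.out : p.Prime).ne_zero)
  have hm' : (p : ℂ_[p]) ^ n = ((m + 1 : ℕ) : ℂ_[p]) := by exact_mod_cast hm
  have hm0 : ((m + 1 : ℕ) : ℂ_[p]) ≠ 0 := by exact_mod_cast Nat.succ_ne_zero m
  rw [hm', hm, Nat.add_sub_cancel, tsum_eq_sum (s := Finset.range (m + 1)),
    div_eq_iff hm0, add_comm 1 x, add_pow, Finset.sum_range_succ']
  · simp only [one_pow, mul_one, pow_zero, Nat.choose_zero_right, Nat.cast_one, add_sub_cancel_right]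
    rw [Finset.sum_mul]
    refine Finset.sum_congr rfl fun k _ => ?_
    have hk : ((k + 1 : ℕ) : ℂ_[p]) ≠ 0 := by exact_mod_cast Nat.succ_ne_zero k
    have h := congrArg (Nat.cast : ℕ → ℂ_[p]) (Nat.add_one_mul_choose_eq m k)
    simp only [Nat.cast_mul] at h
    field_simp
    linear_combination -x ^ (k + 1) * h
  · intro k hk
    rw [Nat.choose_eq_zero_of_lt (by simpa using hk)]
    simp

/-- The logarithm is the derivative at `t = 0` of `(1 + x)^t`, taken along `t = p^n → 0`. This makes
its additivity accessible without manipulating power series. -/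
theorem tendsto_logSeries {x : ℂ_[p]} (hx : ‖x‖ < 1) :
    Tendsto (fun n : ℕ => ((1 + x) ^ p ^ n - 1) / (p : ℂ_[p]) ^ n) atTop
      (𝓝 (logSeries p x)) := by
  simp_rw [one_add_pow_sub_one_div]
  refine tendsto_tsum_of_dominated_convergence
    (summable_succ_mul_pow_succ (norm_nonneg x) hx) (fun k => ?_) (.of_forall fun n k => ?_)
  · exact ((tendsto_choose k).mul_const _).div_const _
  · exact norm_mul_pow_div_le (IsUltrametricDist.norm_natCast_le_one _ _) le_rfl k

theorem norm_eq_one_of_norm_sub_one_lt {u : ℂ_[p]} (hu : ‖u - 1‖ < 1) : ‖u‖ = 1 := by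
  have h := IsUltrametricDist.norm_add_eq_max_of_norm_ne_norm (x := u - 1) (y := 1)
    (by simpa using hu.ne)
  simpa [hu.le] using h

theorem norm_mul_sub_one_lt {u v : ℂ_[p]} (hu : ‖u - 1‖ < 1) (hv : ‖v - 1‖ < 1) :
    ‖u * v - 1‖ < 1 := by
  have h : u * v - 1 = u * (v - 1) + (u - 1) := by ring
  rw [h]
  refine (IsUltrametricDist.norm_add_le_max _ _).trans_lt (max_lt ?_ hu)
  rwa [norm_mul, norm_eq_one_of_norm_sub_one_lt hu, one_mul]

theorem norm_pow_sub_one_lt {u : ℂ_[p]} (hu : ‖u - 1‖ < 1) (n : ℕ) : ‖u ^ n - 1‖ < 1 := by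
  induction n with
  | zero => simp
  | succ n ih => rw [pow_succ]; exact norm_mul_sub_one_lt ih hu

/-- With `q = p^n`, `U = (u^q - 1)/q` and `V = (v^q - 1)/q`, the quotient for `uv` is `UVq + U + V`,
and `UVq → 0`. -/
theorem logSeries_mul {u v : ℂ_[p]} (hu : ‖u - 1‖ < 1) (hv : ‖v - 1‖ < 1) :
    logSeries p (u * v - 1) = logSeries p (u - 1) + logSeries p (v - 1) := by
  have h1 := tendsto_logSeries hu
  have h2 := tendsto_logSeries hv
  have h3 := tendsto_logSeries (norm_mul_sub_one_lt hu hv)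
  simp only [add_sub_cancel] at h1 h2 h3
  have h4 : Tendsto (fun n : ℕ => ((u * v) ^ p ^ n - 1) / (p : ℂ_[p]) ^ n) atTop
      (𝓝 (logSeries p (u - 1) + logSeries p (v - 1))) := by
    have h := ((h1.mul h2).mul (tendsto_prime_pow (p := p))).add (h1.add h2)
    rw [mul_zero, zero_add] at h
    refine h.congr fun n => ?_
    have := prime_ne_zero p
    rw [mul_pow]
    field_simp
    ring
  exact tendsto_nhds_unique h3 h4

theorem logSeries_pow {u : ℂ_[p]} (hu : ‖u - 1‖ < 1) (n : ℕ) :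
    logSeries p (u ^ n - 1) = n * logSeries p (u - 1) := by
  induction n with
  | zero => simp [logSeries]
  | succ n ih =>
    rw [pow_succ, logSeries_mul (norm_pow_sub_one_lt hu n) hu, ih]
    push_cast
    ring

/-- Some positive power of `z` is a power of `p` times a principal unit. This is the condition
under which `padicLog` takes its intended value. -/
def HasLog (z : ℂ_[p]) : Prop :=
  ∃ Na : ℕ × ℤ, 0 < Na.1 ∧ ‖z ^ Na.1 * (p : ℂ_[p]) ^ (-Na.2) - 1‖ < 1

theorem padicLog_eq {z : ℂ_[p]} {N : ℕ} {a : ℤ} (hN : 0 < N)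
    (h : ‖z ^ N * (p : ℂ_[p]) ^ (-a) - 1‖ < 1) :
    padicLog p z = (N : ℂ_[p])⁻¹ * logSeries p (z ^ N * (p : ℂ_[p]) ^ (-a) - 1) := by
  have hex : ∃ Na : ℕ × ℤ, 0 < Na.1 ∧ ‖z ^ Na.1 * (p : ℂ_[p]) ^ (-Na.2) - 1‖ < 1 :=
    ⟨(N, a), hN, h⟩
  have hsp := hex.choose_spec
  rw [padicLog, dif_pos hex]
  set M := hex.choose.1
  set b := hex.choose.2
  obtain ⟨hM, h'⟩ := hsp
  have hp := prime_ne_zero p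
  have hu : (z ^ N * (p : ℂ_[p]) ^ (-a)) ^ M = z ^ (N * M) * (p : ℂ_[p]) ^ (-a * M) := by
    rw [mul_pow, pow_mul, zpow_mul, zpow_natCast]
  have hv : (z ^ M * (p : ℂ_[p]) ^ (-b)) ^ N = z ^ (N * M) * (p : ℂ_[p]) ^ (-b * N) := by
    rw [mul_pow, mul_comm N M, pow_mul, zpow_mul, zpow_natCast]
  have hu1 := norm_eq_one_of_norm_sub_one_lt (norm_pow_sub_one_lt h M)
  have hv1 := norm_eq_one_of_norm_sub_one_lt (norm_pow_sub_one_lt h' N)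
  rw [hu, norm_mul, norm_zpow] at hu1
  rw [hv, norm_mul, norm_zpow] at hv1
  have hz : ‖z ^ (N * M)‖ ≠ 0 := fun h0 => by simp [h0] at hu1
  -- Principal units have norm one, so the norm of `z ^ (N * M)` determines the exponent of `p`; the
  -- two chosen pairs then lead to the same element.
  have hab : -a * M = -b * N := by
    have h2 : ‖(p : ℂ_[p])‖ ^ (-a * (M : ℤ)) = ‖(p : ℂ_[p])‖ ^ (-b * (N : ℤ)) :=
      mul_left_cancel₀ hz (hu1.trans hv1.symm)
    exact zpow_right_injective₀ (norm_pos_iff.2 hp) (norm_prime_lt_one p).ne h2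
  have hlog := logSeries_pow h M
  have hlog' := logSeries_pow h' N
  rw [hu, hab, ← hv, hlog'] at hlog
  have hN0 : (N : ℂ_[p]) ≠ 0 := by exact_mod_cast hN.ne'
  have hM0 : (M : ℂ_[p]) ≠ 0 := by exact_mod_cast hM.ne'
  field_simp
  linear_combination hlog

theorem mul_pow_mul_zpow (x y : ℂ_[p]) (N M : ℕ) (a b : ℤ) :
    (x * y) ^ (N * M) * (p : ℂ_[p]) ^ (-(a * M + b * N)) =
      (x ^ N * (p : ℂ_[p]) ^ (-a)) ^ M * (y ^ M * (p : ℂ_[p]) ^ (-b)) ^ N := by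
  have hp := prime_ne_zero p
  have : -(a * M + b * N : ℤ) = (-a) * M + (-b) * N := by ring
  rw [this, zpow_add₀ hp, zpow_mul, zpow_mul, zpow_natCast, zpow_natCast, mul_pow, mul_pow, mul_pow,
    ← pow_mul, ← pow_mul y, mul_comm M N]
  ring

theorem HasLog.mul {x y : ℂ_[p]} (hx : HasLog x) (hy : HasLog y) : HasLog (x * y) := by
  obtain ⟨⟨N, a⟩, hN, hx⟩ := hx
  obtain ⟨⟨M, b⟩, hM, hy⟩ := hy
  refine ⟨(N * M, a * M + b * N), Nat.mul_pos hN hM, ?_⟩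
  simp only at hx hy ⊢
  rw [mul_pow_mul_zpow]
  exact norm_mul_sub_one_lt (norm_pow_sub_one_lt hx M) (norm_pow_sub_one_lt hy N)

theorem padicLog_mul {x y : ℂ_[p]} (hx : HasLog x) (hy : HasLog y) :
    padicLog p (x * y) = padicLog p x + padicLog p y := by
  obtain ⟨⟨N, a⟩, hN, hx⟩ := hx
  obtain ⟨⟨M, b⟩, hM, hy⟩ := hy
  simp only at hN hM hx hy
  have hxM := norm_pow_sub_one_lt hx M
  have hyN := norm_pow_sub_one_lt hy N
  have h := norm_mul_sub_one_lt hxM hyN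
  rw [← mul_pow_mul_zpow] at h
  rw [padicLog_eq hN hx, padicLog_eq hM hy, padicLog_eq (Nat.mul_pos hN hM) h, mul_pow_mul_zpow,
    logSeries_mul hxM hyN, logSeries_pow hx, logSeries_pow hy]
  have hN0 : (N : ℂ_[p]) ≠ 0 := by exact_mod_cast hN.ne'
  have hM0 : (M : ℂ_[p]) ≠ 0 := by exact_mod_cast hM.ne'
  push_cast
  field_simp

theorem HasLog.of_norm_sub_one_lt {u : ℂ_[p]} (hu : ‖u - 1‖ < 1) : HasLog u :=
  ⟨(1, 0), one_pos, by simpa using hu⟩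

theorem padicLog_of_norm_sub_one_lt {u : ℂ_[p]} (hu : ‖u - 1‖ < 1) :
    padicLog p u = logSeries p (u - 1) := by
  have := padicLog_eq (z := u) (N := 1) (a := 0) one_pos (by simpa using hu)
  simpa using this

theorem HasLog.of_pow_eq_one {z : ℂ_[p]} {n : ℕ} (hn : 0 < n) (hz : z ^ n = 1) : HasLog z :=
  ⟨(n, 0), hn, by simp [hz]⟩

theorem padicLog_of_pow_eq_one {z : ℂ_[p]} {n : ℕ} (hn : 0 < n) (hz : z ^ n = 1) :
    padicLog p z = 0 := by
  rw [padicLog_eq (z := z) (N := n) (a := 0) hn (by simp [hz])]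
  simp [hz, logSeries]

theorem HasLog.prod {ι : Type*} (s : Finset ι) (g : ι → ℂ_[p]) (h : ∀ i ∈ s, HasLog (g i)) :
    HasLog (∏ i ∈ s, g i) :=
  Finset.prod_induction g HasLog (fun _ _ => HasLog.mul)
    (HasLog.of_pow_eq_one one_pos (one_pow 1)) h

theorem padicLog_prod {ι : Type*} (s : Finset ι) (g : ι → ℂ_[p]) (h : ∀ i ∈ s, HasLog (g i)) :
    padicLog p (∏ i ∈ s, g i) = ∑ i ∈ s, padicLog p (g i) := by
  classical
  induction s using Finset.induction_on with
  | empty => simpa using padicLog_of_pow_eq_one (p := p) one_pos (one_pow 1)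
  | insert a s ha ih =>
    have hs : ∀ i ∈ s, HasLog (g i) := fun i hi => h i (Finset.mem_insert_of_mem hi)
    rw [Finset.prod_insert ha, Finset.sum_insert ha,
      padicLog_mul (h a (Finset.mem_insert_self a s)) (HasLog.prod s g hs), ih hs]

theorem padicLog_neg {z : ℂ_[p]} (hz : HasLog z) : padicLog p (-z) = padicLog p z := by
  have h : (-1 : ℂ_[p]) ^ 2 = 1 := by norm_num
  rw [← neg_one_mul, padicLog_mul (HasLog.of_pow_eq_one two_pos h) hz,
    padicLog_of_pow_eq_one two_pos h, zero_add]

theorem hasLog_prime : HasLog (p : ℂ_[p]) :=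
  ⟨(1, 1), one_pos, by simp [mul_inv_cancel₀ (prime_ne_zero p)]⟩

/-- After removing the power of `p`, Fermat's little theorem makes the `(p - 1)`-th power a
principal unit. -/
theorem hasLog_natCast {n : ℕ} (hn : n ≠ 0) : HasLog (n : ℂ_[p]) := by
  have hp : p.Prime := Fact.out
  obtain ⟨e, m, hm, rfl⟩ := Nat.exists_eq_pow_mul_and_not_dvd hn p hp.ne_one
  push_cast
  refine HasLog.mul ?_ ⟨(p - 1, 0), Nat.sub_pos_of_lt hp.one_lt, ?_⟩
  · rw [← Finset.card_range e, ← Finset.prod_const]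
    exact HasLog.prod _ _ fun _ _ => hasLog_prime
  · have h : ((p : ℤ)) ∣ (m : ℤ) ^ (p - 1) - 1 := by
      have hc : IsCoprime (m : ℤ) p :=
        Nat.isCoprime_iff_coprime.2 ((Nat.Prime.coprime_iff_not_dvd hp).2 hm).symm
      exact (Int.ModEq.pow_card_sub_one_eq_one hp hc).symm.dvd
    obtain ⟨k, hk⟩ := h
    have hk' : (m : ℂ_[p]) ^ (p - 1) - 1 = (p : ℂ_[p]) * (k : ℂ_[p]) := by
      exact_mod_cast congrArg (Int.cast : ℤ → ℂ_[p]) hk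
    simp only [neg_zero, zpow_zero, mul_one]
    rw [hk', norm_mul]
    calc ‖(p : ℂ_[p])‖ * ‖(k : ℂ_[p])‖ ≤ ‖(p : ℂ_[p])‖ * 1 := by
          gcongr; exact IsUltrametricDist.norm_intCast_le_one _ _
      _ < 1 := by rw [mul_one]; exact norm_prime_lt_one p

theorem hasLog_intCast {n : ℤ} (hn : n ≠ 0) : HasLog (n : ℂ_[p]) := by
  have h := hasLog_natCast (p := p) (Int.natAbs_ne_zero.2 hn)
  rcases Int.natAbs_eq n with h' | h'
  · rw [h', Int.cast_natCast]; exact h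
  · have h2 : (-1 : ℂ_[p]) ^ 2 = 1 := by norm_num
    rw [h', Int.cast_neg, Int.cast_natCast, ← neg_one_mul]
    exact (HasLog.of_pow_eq_one two_pos h2).mul h

end Log

/-! ### Norms and indices over finite free `ℤ`-algebras. -/

section Algebra

/-- If a finite free `ℤ`-algebra has as many ring homomorphisms to a field as its rank, then the
norm of an element is the product of its images. -/
theorem norm_eq_prod_ringHom {A E ι : Type*} [CommRing A] [Module.Free ℤ A] [Module.Finite ℤ A]
    [Field E] [Fintype ι] (φ : ι → A →+* E) (hφ : Function.Injective φ)
    (hcard : Fintype.card ι = Module.finrank ℤ A) (a : A) :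
    ((Algebra.norm ℤ a : ℤ) : E) = ∏ i, φ i a := by
  classical
  let b : Module.Basis ι ℤ A := (Module.finBasis ℤ A).reindex
    (Fintype.equivOfCardEq (by rw [Fintype.card_fin, hcard]))
  let P : Matrix ι ι E := Matrix.of fun j i => φ j (b i)
  -- Dedekind's independence of characters: a relation between the `φ j` on the basis extends to all
  -- of `A` by additivity.
  have hind : LinearIndependent E P.row := by
    have h1 : LinearIndependent E fun j => ((φ j : A →* E) : A → E) :=
      (linearIndependent_monoidHom A E).comp (fun j => (φ j : A →* E)) fun i j h =>
        hφ (RingHom.ext fun x => DFunLike.congr_fun h x)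
    rw [Fintype.linearIndependent_iff] at h1 ⊢
    intro g hg
    refine h1 g (funext fun x => ?_)
    have hadd : (∑ j, (g j) • (φ j : A →+ E) : A →+ E).toIntLinearMap = 0 := by
      refine b.ext fun i => ?_
      have := congrFun hg i
      simpa [P, Finset.sum_apply] using this
    simpa [Finset.sum_apply] using LinearMap.congr_fun hadd x
  have hdet : P.det ≠ 0 :=
    ((Matrix.isUnit_iff_isUnit_det P).1 (Matrix.linearIndependent_rows_iff_isUnit.1 hind)).ne_zero
  -- `P` diagonalises multiplication by `a`, whose determinant is the norm.
  have hmul : Matrix.diagonal (fun j => φ j a) * P =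
      P * (Algebra.leftMulMatrix b a).map (Int.castRingHom E) := by
    ext j i
    rw [Matrix.diagonal_mul, Matrix.mul_apply]
    simp only [P, Matrix.of_apply, Matrix.map_apply, Algebra.leftMulMatrix_eq_repr_mul]
    rw [← map_mul]
    conv_lhs => rw [← b.sum_repr (a * b i), map_sum]
    refine Finset.sum_congr rfl fun k _ => ?_
    simp [mul_comm]
  have h := congrArg Matrix.det hmul
  rw [Matrix.det_mul, Matrix.det_mul, Matrix.det_diagonal, mul_comm] at h
  have h' := mul_left_cancel₀ hdet h
  rw [h', Algebra.norm_eq_matrix_det b]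
  exact Int.cast_det _

/-- The determinant over `ℤ` of a square matrix over a finite free `ℤ`-algebra. -/
theorem natAbs_norm_det_eq_card {A : Type*} [CommRing A] [Module.Free ℤ A]
    [Module.Finite ℤ A] {s : ℕ} (g : Matrix (Fin s) (Fin s) A)
    (hg : Algebra.norm ℤ g.det ≠ 0) :
    Nat.card ((Fin s → A) ⧸ LinearMap.range g.mulVecLin) = (Algebra.norm ℤ g.det).natAbs := by
  have hdet : LinearMap.det (g.mulVecLin.restrictScalars ℤ) = Algebra.norm ℤ g.det := by
    rw [LinearMap.det_restrictScalars, ← Matrix.toLin'_apply', LinearMap.det_toLin']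
  have hinj : Function.Injective (g.mulVecLin.restrictScalars ℤ) := by
    rw [← LinearMap.ker_eq_bot]
    by_contra h
    exact hg (hdet ▸ LinearMap.det_eq_zero_iff_ker_ne_bot.2 h)
  let e := LinearEquiv.ofInjective _ hinj
  have h := Submodule.natAbs_det_equiv (LinearMap.range (g.mulVecLin.restrictScalars ℤ)) e
  rw [← hdet]
  exact h.symm
end Algebra

/-! ### Evaluation of Laurent polynomials as a ring homomorphism. -/

namespace Laurent

section Eval

/-- Evaluation at a point with nonzero coordinates is a ring homomorphism. -/
def evalHom {A F : Type*} [CommRing A] [Field F] (τ : A →+* F) {d : ℕ} (z : Fin d → Fˣ) :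
    Laurent A d →+* F :=
  AddMonoidAlgebra.liftNCRingHom τ
    { toFun := fun ν => ((∏ i, z i ^ (ν.toAdd i) : Fˣ) : F)
      map_one' := by simp
      map_mul' := fun ν μ => by simp [zpow_add, Finset.prod_mul_distrib] }
    fun _ _ => Commute.all _ _

variable {A F : Type*} [CommRing A] [Field F] {d : ℕ}

@[simp]
theorem evalHom_single (τ : A →+* F) (z : Fin d → Fˣ) (ν : Fin d → ℤ) (a : A) :
    evalHom τ z (AddMonoidAlgebra.single ν a) = τ a * ∏ i, (z i : F) ^ ν i := by
  simp [evalHom, AddMonoidAlgebra.liftNCRingHom]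

theorem eval_eq_evalHom (z : Fin d → Fˣ) (f : Laurent F d) :
    f.eval (fun i => (z i : F)) = evalHom (RingHom.id F) z f := by
  conv_rhs => rw [← AddMonoidAlgebra.sum_coeff_single f]
  rw [Finsupp.sum, map_sum]
  simp [eval, Finsupp.sum]

theorem evalHom_mapCoeff {B : Type*} [CommRing B] (σ : A →+* B) (τ : B →+* F) (z : Fin d → Fˣ)
    (f : Laurent A d) : evalHom τ z (mapCoeff d σ f) = evalHom (τ.comp σ) z f := by
  induction f using AddMonoidAlgebra.induction_linear with
  | zero => simp
  | add x y hx hy => rw [map_add, map_add, hx, hy, map_add]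
  | single m r => simp [mapCoeff]

end Eval

end Laurent

/-! ### Reduction of exponents modulo `n`. -/

section Reduction

variable (A : Type*) [CommRing A] (d n : ℕ)

/-- Reduction of exponents modulo `n`. -/
def expMod : (Fin d → ℤ) →+ (Fin d → ZMod n) where
  toFun ν i := ν i
  map_zero' := by ext; simp
  map_add' ν μ := by ext; simp

theorem expMod_apply (ν : Fin d → ℤ) (i : Fin d) : expMod d n ν i = (ν i : ZMod n) := rfl

theorem expMod_surjective : Function.Surjective (expMod d n) := fun x =>
  ⟨fun i => (ZMod.intCast_surjective (x i)).choose,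
    funext fun i => (ZMod.intCast_surjective (x i)).choose_spec⟩

theorem ker_expMod : (expMod d n).ker = multiples d n := by
  ext ν
  simp only [AddMonoidHom.mem_ker, multiples, AddSubgroup.mem_pi, Set.mem_univ, true_imp_iff,
    Int.mem_zmultiples_iff, funext_iff, expMod_apply, Pi.zero_apply,
    ZMod.intCast_zmod_eq_zero_iff_dvd]

theorem index_multiples : (multiples d n).index = n ^ d := by
  rw [← ker_expMod, AddSubgroup.index_ker, AddMonoidHom.range_eq_top.2 (expMod_surjective d n)]
  simp [Nat.card_pi]

/-- The group ring of `(ℤ/n)^d`. -/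
abbrev FiniteLaurent : Type _ := AddMonoidAlgebra A (Fin d → ZMod n)

/-- The reduction `A[ℤ^d] → A[(ℤ/n)^d]`. -/
abbrev reduction : Laurent A d →+* FiniteLaurent A d n :=
  AddMonoidAlgebra.mapDomainRingHom A (expMod d n)

theorem reduction_single (ν : Fin d → ℤ) (a : A) :
    reduction A d n (AddMonoidAlgebra.single ν a) =
      AddMonoidAlgebra.single (expMod d n ν) a := by
  simp [reduction]

theorem reduction_surjective : Function.Surjective (reduction A d n) := by
  intro x
  induction x using AddMonoidAlgebra.induction_linear with
  | zero => exact ⟨0, map_zero _⟩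
  | add x y hx hy =>
    obtain ⟨x', rfl⟩ := hx
    obtain ⟨y', rfl⟩ := hy
    exact ⟨x' + y', map_add _ _ _⟩
  | single m r =>
    obtain ⟨ν, rfl⟩ := expMod_surjective d n m
    exact ⟨_, reduction_single A d n ν r⟩

variable {A d n}

/-- An additive map on Laurent polynomials that is invariant under the shifts by `(nℤ)^d` vanishes
on the kernel of the reduction. -/
theorem eq_zero_of_reduction_eq_zero {Y : Type*} [AddCommGroup Y] (φ : Laurent A d →+ Y)
    (hφ : ∀ δ ∈ multiples d n, ∀ g, φ (Laurent.monomial A δ * g) = φ g) {g : Laurent A d}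
    (hg : reduction A d n g = 0) : φ g = 0 := by
  -- `σ` moves each residue class to a chosen representative; by invariance `φ` does not notice the
  -- change of exponents.
  let σ : FiniteLaurent A d n → Laurent A d :=
    AddMonoidAlgebra.mapDomain (Function.surjInv (expMod_surjective d n))
  have h : ∀ g : Laurent A d, φ g = φ (σ (reduction A d n g)) := by
    intro g
    induction g using AddMonoidAlgebra.induction_linear with
    | zero => simp [σ]
    | add x y hx hy =>
      rw [map_add, hx, hy, map_add, ← map_add]
      simp [σ, AddMonoidAlgebra.mapDomain_add]
    | single m r =>
      rw [reduction_single]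
      simp only [σ, AddMonoidAlgebra.mapDomain_single]
      set m' := Function.surjInv (expMod_surjective d n) (expMod d n m)
      have hm : m - m' ∈ multiples d n := by
        rw [← ker_expMod, AddMonoidHom.mem_ker, map_sub,
          Function.surjInv_eq (expMod_surjective d n), sub_self]
      rw [← hφ _ hm (AddMonoidAlgebra.single m' r)]
      simp [Laurent.monomial, AddMonoidAlgebra.single_mul_single]
  rw [h, hg]
  simp [σ]

variable {F : Type*} [Field F] [NeZero n]

/-- Evaluation of elements of `A[(ℤ/n)^d]` at a tuple of `n`-th roots of unity. -/
def evalFinite (τ : A →+* F) (z : Fin d → F) (hz : ∀ i, z i ^ n = 1) :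
    FiniteLaurent A d n →+* F :=
  AddMonoidAlgebra.liftNCRingHom τ
    { toFun := fun x => ∏ i, AddChar.zmodChar n (hz i) (x.toAdd i)
      map_one' := by simp
      map_mul' := fun ν μ => by simp [AddChar.map_add_eq_mul, Finset.prod_mul_distrib] }
    fun _ _ => Commute.all _ _

theorem zmodChar_intCast {z : F} (hz : z ^ n = 1) (k : ℤ) :
    AddChar.zmodChar n hz (k : ZMod n) = z ^ k := by
  have h := AddChar.map_zsmul_eq_zpow (AddChar.zmodChar n hz) k 1
  rw [zsmul_one] at h
  rw [h]
  congr 1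
  simpa using AddChar.zmodChar_apply' hz 1

theorem evalFinite_single (τ : A →+* F) (z : Fin d → F) (hz : ∀ i, z i ^ n = 1)
    (x : Fin d → ZMod n) (a : A) :
    evalFinite τ z hz (AddMonoidAlgebra.single x a) =
      τ a * ∏ i, AddChar.zmodChar n (hz i) (x i) := by
  simp [evalFinite, AddMonoidAlgebra.liftNCRingHom]

theorem evalFinite_reduction (τ : A →+* F) (z : Fin d → Fˣ) (hz : ∀ i, (z i : F) ^ n = 1)
    (g : Laurent A d) :
    evalFinite τ (fun i => (z i : F)) hz (reduction A d n g) = Laurent.evalHom τ z g := by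
  induction g using AddMonoidAlgebra.induction_linear with
  | zero => simp
  | add x y hx hy => rw [map_add, map_add, hx, hy, map_add]
  | single m r =>
    rw [reduction_single, evalFinite_single, Laurent.evalHom_single]
    simp [expMod_apply, zmodChar_intCast]

/-- Constants recover the coefficient map, and the `k`-th generator of `(ℤ/n)^d` recovers the `k`-th
coordinate. -/
theorem evalFinite_injective {ι : Type*} (τ : ι → A →+* F) (hτ : Function.Injective τ)
    {i j : ι} {z w : Fin d → F} {hz : ∀ i, z i ^ n = 1} {hw : ∀ i, w i ^ n = 1}
    (h : evalFinite (τ i) z hz = evalFinite (τ j) w hw) : i = j ∧ z = w := by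
  constructor
  · refine hτ (RingHom.ext fun a => ?_)
    have := DFunLike.congr_fun h (AddMonoidAlgebra.single 0 a)
    simpa [evalFinite_single] using this
  · funext k
    have := DFunLike.congr_fun h (AddMonoidAlgebra.single (Pi.single k 1) 1)
    simp only [evalFinite_single, map_one, one_mul] at this
    rw [Fintype.prod_eq_single k, Fintype.prod_eq_single k] at this
    · have h1 := zmodChar_intCast (hz k) 1
      have h2 := zmodChar_intCast (hw k) 1
      simp only [Int.cast_one, zpow_one] at h1 h2
      rw [Pi.single_eq_same, h1, h2] at this
      exact this
    · intro x hx
      simp [Pi.single_eq_of_ne hx]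
    · intro x hx
      simp [Pi.single_eq_of_ne hx]

end Reduction

/-! ### Fixed points as characters of a finite cokernel. -/

section DualSystem

variable {A : Type*} [CommRing A] {d s : ℕ} (n : ℕ)
  (f : Matrix (Fin s) (Fin s) (Laurent A d))

/-- The cokernel of the reduction of `f` modulo `(nℤ)^d`. -/
abbrev FiniteCoker : Type _ :=
  (Fin s → FiniteLaurent A d n) ⧸ LinearMap.range (f.map (reduction A d n)).mulVecLin

/-- The projection onto the cokernel of `f`, as an additive map. -/
def cokerMk : (Fin s → Laurent A d) →+ Coker f :=
  (LinearMap.range f.mulVecLin).mkQ.toAddMonoidHom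

theorem cokerMk_surjective : Function.Surjective (cokerMk f) :=
  (LinearMap.range f.mulVecLin).mkQ_surjective

theorem cokerMk_smul (a : Laurent A d) (y : Fin s → Laurent A d) :
    cokerMk f (a • y) = a • cokerMk f y :=
  (LinearMap.range f.mulVecLin).mkQ.map_smul a y

theorem cokerMk_mulVec (y : Fin s → Laurent A d) : cokerMk f (f.mulVec y) = 0 :=
  (Submodule.Quotient.mk_eq_zero _).2 ⟨y, rfl⟩

/-- Coordinatewise reduction modulo `(nℤ)^d`, followed by projection to the finite cokernel. -/
def toFiniteCoker : (Fin s → Laurent A d) →+ FiniteCoker n f :=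
  (LinearMap.range (f.map (reduction A d n)).mulVecLin).mkQ.toAddMonoidHom.comp
    ((reduction A d n).toAddMonoidHom.compLeft (Fin s))

theorem toFiniteCoker_apply (y : Fin s → Laurent A d) :
    toFiniteCoker n f y = Submodule.Quotient.mk (reduction A d n ∘ y) := rfl

theorem toFiniteCoker_mulVec (y : Fin s → Laurent A d) :
    toFiniteCoker n f (f.mulVec y) = 0 := by
  rw [toFiniteCoker_apply, Submodule.Quotient.mk_eq_zero]
  exact ⟨reduction A d n ∘ y, (funext fun i => RingHom.map_mulVec _ f y i).symm⟩

/-- The reduction map from the cokernel of `f` to the cokernel of its reduction. -/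
def cokerReduction : Coker f →+ FiniteCoker n f :=
  QuotientAddGroup.lift (LinearMap.range f.mulVecLin).toAddSubgroup (toFiniteCoker n f) (by
    rintro _ ⟨y, rfl⟩
    exact toFiniteCoker_mulVec n f y)

theorem cokerReduction_cokerMk (y : Fin s → Laurent A d) :
    cokerReduction n f (cokerMk f y) = toFiniteCoker n f y := rfl

theorem cokerReduction_surjective : Function.Surjective (cokerReduction n f) := by
  intro x
  obtain ⟨x, rfl⟩ := Submodule.Quotient.mk_surjective _ x
  refine ⟨cokerMk f fun i => (reduction_surjective A d n (x i)).choose, ?_⟩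
  rw [cokerReduction_cokerMk, toFiniteCoker_apply]
  congr 1
  exact funext fun i => (reduction_surjective A d n (x i)).choose_spec

variable {n}

theorem cokerReduction_monomial_smul {δ : Fin d → ℤ} (hδ : δ ∈ multiples d n) (x : Coker f) :
    cokerReduction n f (Laurent.monomial A δ • x) = cokerReduction n f x := by
  obtain ⟨y, rfl⟩ := cokerMk_surjective f x
  rw [← cokerMk_smul, cokerReduction_cokerMk, cokerReduction_cokerMk, toFiniteCoker_apply,
    toFiniteCoker_apply]
  congr 1
  funext i
  rw [← ker_expMod, AddMonoidHom.mem_ker] at hδ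
  simp only [Function.comp_apply, Pi.smul_apply, smul_eq_mul, map_mul, Laurent.monomial]
  rw [reduction_single, hδ, ← AddMonoidAlgebra.one_def, one_mul]

/-- An additive map on the cokernel of `f` that is invariant under `(nℤ)^d` vanishes on the kernel
of the reduction. -/
theorem eq_zero_of_cokerReduction_eq_zero {Y : Type*} [AddCommGroup Y] (φ : Coker f →+ Y)
    (hφ : ∀ δ ∈ multiples d n, ∀ x, φ (Laurent.monomial A δ • x) = φ x) {x : Coker f}
    (hx : cokerReduction n f x = 0) : φ x = 0 := by
  obtain ⟨y, rfl⟩ := cokerMk_surjective f x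
  rw [cokerReduction_cokerMk, toFiniteCoker_apply, Submodule.Quotient.mk_eq_zero] at hx
  obtain ⟨w, hw⟩ := hx
  choose v hv using fun i => reduction_surjective A d n (w i)
  obtain rfl : (reduction A d n) ∘ v = w := funext hv
  -- Subtracting `f.mulVec v` keeps the class of `y` and makes every coordinate reduce to zero, so
  -- the statement for Laurent polynomials applies coordinatewise.
  have hker : ∀ i, reduction A d n ((y - f.mulVec v) i) = 0 := by
    intro i
    have h := congrFun hw i
    rw [Matrix.mulVecLin_apply] at h
    rw [Pi.sub_apply, map_sub, RingHom.map_mulVec, h, Function.comp_apply, sub_self]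
  have hy : cokerMk f y = cokerMk f (y - f.mulVec v) := by
    rw [map_sub, cokerMk_mulVec, sub_zero]
  rw [hy, ← Finset.univ_sum_single (y - f.mulVec v), map_sum, map_sum]
  refine Finset.sum_eq_zero fun i _ => ?_
  refine eq_zero_of_reduction_eq_zero (n := n)
    ((φ.comp (cokerMk f)).comp (AddMonoidHom.single (fun _ => Laurent A d) i))
    (fun δ hδ g => ?_) (hker i)
  simp only [AddMonoidHom.comp_apply, AddMonoidHom.single_apply]
  rw [← hφ δ hδ (cokerMk f (Pi.single i g)), ← cokerMk_smul, ← Pi.single_smul, smul_eq_mul]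

variable (n)

/-- Pull back a character of the finite cokernel. -/
def pullbackChar (ψ : AddChar (FiniteCoker n f) Circle) : DualSystem f :=
  (⟨(ψ.compAddMonoidHom (cokerReduction n f)).toMonoidHom, continuous_of_discreteTopology⟩ :
    Multiplicative (Coker f) →ₜ* Circle)

theorem pullbackChar_apply (ψ : AddChar (FiniteCoker n f) Circle)
    (x : Multiplicative (Coker f)) :
    pullbackChar n f ψ x = ψ (cokerReduction n f x.toAdd) := rfl

theorem pullbackChar_injective : Function.Injective (pullbackChar n f) := by
  intro ψ ψ' h
  ext x
  obtain ⟨x, rfl⟩ := cokerReduction_surjective n f x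
  exact congrArg _ (DFunLike.congr_fun h (Multiplicative.ofAdd x))

theorem mem_fixedSet_iff (χ : DualSystem f) :
    χ ∈ fixedSet d n (DualSystem f) ↔ ∀ δ ∈ multiples d n, ∀ x : Coker f,
      χ (Multiplicative.ofAdd (Laurent.monomial A δ • x)) = χ (Multiplicative.ofAdd x) := by
  constructor
  · intro h δ hδ x
    exact DFunLike.congr_fun (h ⟨δ, hδ⟩) (Multiplicative.ofAdd x)
  · rintro h ⟨δ, hδ⟩
    exact PontryaginDual.ext fun x => h δ hδ x.toAdd

/-- A fixed character is invariant under `(nℤ)^d`, hence trivial on the kernel of the reduction, and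
so descends to the finite cokernel. -/
theorem range_pullbackChar : Set.range (pullbackChar n f) = fixedSet d n (DualSystem f) := by
  ext χ
  rw [mem_fixedSet_iff]
  constructor
  · rintro ⟨ψ, rfl⟩ δ hδ x
    simp only [pullbackChar_apply, toAdd_ofAdd]
    rw [cokerReduction_monomial_smul f hδ]
  · intro h
    let φ : Coker f →+ Additive Circle :=
      MonoidHom.toAdditiveRight (χ : Multiplicative (Coker f) →* Circle)
    have hφ : ∀ x, cokerReduction n f x = 0 → φ x = 0 := fun x =>
      eq_zero_of_cokerReduction_eq_zero f φ fun δ hδ y => h δ hδ y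
    let ψ : FiniteCoker n f →+ Additive Circle :=
      AddMonoidHom.liftOfSurjective (cokerReduction n f) (cokerReduction_surjective n f) ⟨φ, hφ⟩
    refine ⟨AddChar.toAddMonoidHomEquiv.symm ψ, PontryaginDual.ext fun x => ?_⟩
    exact AddMonoidHom.liftOfRightInverse_comp_apply (cokerReduction n f) _
      (Function.rightInverse_surjInv (cokerReduction_surjective n f)) ⟨φ, hφ⟩ x.toAdd

theorem finite_fixedSet [Finite (FiniteCoker n f)] : (fixedSet d n (DualSystem f)).Finite := by
  have := Fintype.ofFinite (FiniteCoker n f)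
  have : Finite (AddChar (FiniteCoker n f) Circle) :=
    Finite.of_equiv _ AddChar.circleEquivComplex.symm.toEquiv
  rw [← range_pullbackChar]
  exact Set.finite_range _

theorem nonempty_fixedSet : (fixedSet d n (DualSystem f)).Nonempty := by
  rw [← range_pullbackChar]
  exact Set.range_nonempty _

/-- A finite abelian group has as many characters as elements. -/
theorem ncard_fixedSet [Finite (FiniteCoker n f)] :
    (fixedSet d n (DualSystem f)).ncard = Nat.card (FiniteCoker n f) := by
  have := Fintype.ofFinite (FiniteCoker n f)
  rw [← range_pullbackChar, ← Nat.card_coe_set_eq,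
    Nat.card_range_of_injective (pullbackChar_injective n f),
    Nat.card_congr AddChar.circleEquivComplex.toEquiv, Nat.card_eq_fintype_card,
    Nat.card_eq_fintype_card, AddChar.card_eq]

end DualSystem

/-! ### Dominant coefficients of polynomials without zeros of norm one. -/

section DominantCoefficient

open Polynomial

variable {E : Type*} [NormedField E] [IsUltrametricDist E]

/-- If `‖a‖ < 1` the term `X * Q` prevails and the dominant index moves up by one; if `‖a‖ > 1` the
term `a * Q` prevails and the index stays. -/
theorem exists_dominant_coeff_X_sub_C_mul {Q : E[X]} {a : E} (ha : ‖a‖ ≠ 1)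
    (hQ : ∃ m, ∀ j, j ≠ m → ‖Q.coeff j‖ < ‖Q.coeff m‖) :
    ∃ m, ∀ j, j ≠ m → ‖((X - C a) * Q).coeff j‖ < ‖((X - C a) * Q).coeff m‖ := by
  obtain ⟨m, hm⟩ := hQ
  have hm0 : 0 < ‖Q.coeff m‖ := (norm_nonneg _).trans_lt (hm (m + 1) (by omega))
  have hle : ∀ j, ‖Q.coeff j‖ ≤ ‖Q.coeff m‖ := fun j => by
    by_cases h : j = m
    · rw [h]
    · exact (hm j h).le
  have hc0 : ((X - C a) * Q).coeff 0 = -(a * Q.coeff 0) := by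
    simp [sub_mul]
  have hcs : ∀ j, ((X - C a) * Q).coeff (j + 1) = Q.coeff j - a * Q.coeff (j + 1) := fun j => by
    simp [sub_mul]
  rcases lt_or_gt_of_ne ha with ha | ha
  · have hlt : ∀ j, ‖a * Q.coeff j‖ < ‖Q.coeff m‖ := fun j => by
      rw [norm_mul]
      calc ‖a‖ * ‖Q.coeff j‖ ≤ ‖a‖ * ‖Q.coeff m‖ := by gcongr; exact hle j
        _ < 1 * ‖Q.coeff m‖ := by gcongr
        _ = _ := one_mul _
    refine ⟨m + 1, fun j hj => ?_⟩
    have heq : ‖((X - C a) * Q).coeff (m + 1)‖ = ‖Q.coeff m‖ := by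
      rw [hcs, sub_eq_add_neg, IsUltrametricDist.norm_add_eq_max_of_norm_ne_norm
        (by rw [norm_neg]; exact (hlt _).ne'), norm_neg, max_eq_left (hlt _).le]
    rw [heq]
    cases j with
    | zero => rw [hc0, norm_neg]; exact hlt 0
    | succ j =>
      rw [hcs, sub_eq_add_neg]
      refine (IsUltrametricDist.norm_add_le_max _ _).trans_lt (max_lt (hm j (by omega)) ?_)
      rw [norm_neg]
      exact hlt _
  · have hgt : ‖Q.coeff m‖ < ‖a * Q.coeff m‖ := by
      rw [norm_mul]
      exact lt_mul_of_one_lt_left hm0 ha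
    have heq : ‖((X - C a) * Q).coeff m‖ = ‖a * Q.coeff m‖ := by
      cases m with
      | zero => rw [hc0, norm_neg]
      | succ m =>
        have h := (hle m).trans_lt hgt
        rw [hcs, sub_eq_add_neg, IsUltrametricDist.norm_add_eq_max_of_norm_ne_norm
          (by rw [norm_neg]; exact h.ne), norm_neg, max_eq_right h.le]
    refine ⟨m, fun j hj => ?_⟩
    rw [heq]
    have h : ‖a * Q.coeff j‖ < ‖a * Q.coeff m‖ := by
      rw [norm_mul, norm_mul]
      exact mul_lt_mul_of_pos_left (hm j hj) (one_pos.trans ha)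
    cases j with
    | zero => rwa [hc0, norm_neg]
    | succ j =>
      rw [hcs, sub_eq_add_neg]
      refine (IsUltrametricDist.norm_add_le_max _ _).trans_lt (max_lt ((hle j).trans_lt hgt) ?_)
      rwa [norm_neg]

/-- A nonzero polynomial over an algebraically closed nonarchimedean field without roots of norm
`1` has a unique coefficient of maximal norm. -/
theorem exists_dominant_coeff [IsAlgClosed E] {P : E[X]} (hP : P ≠ 0)
    (hroots : ∀ u, P.IsRoot u → ‖u‖ ≠ 1) : ∃ m, ∀ j, j ≠ m → ‖P.coeff j‖ < ‖P.coeff m‖ := by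
  have hsplit := (IsAlgClosed.splits P).eq_prod_roots
  have key : ∀ S : Multiset E, (∀ a ∈ S, ‖a‖ ≠ 1) →
      ∃ m, ∀ j, j ≠ m → ‖(C P.leadingCoeff * (S.map fun a => X - C a).prod).coeff j‖ <
        ‖(C P.leadingCoeff * (S.map fun a => X - C a).prod).coeff m‖ := by
    intro S
    induction S using Multiset.induction_on with
    | empty =>
      refine fun _ => ⟨0, fun j hj => ?_⟩
      simp [coeff_C, hj, hP]
    | cons a S ih =>
      intro h
      have := exists_dominant_coeff_X_sub_C_mul (h a (Multiset.mem_cons_self a S))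
        (ih fun b hb => h b (Multiset.mem_cons_of_mem hb))
      rw [Multiset.map_cons, Multiset.prod_cons, mul_left_comm]
      exact this
  rw [hsplit]
  exact key _ fun a ha => hroots a (isRoot_of_mem_roots ha)

/-- A weight `B` such that `ν ↦ ∑ νᵢ Bⁱ` is injective on a given finite set. -/
theorem exists_injOn_weight {d : ℕ} (S : Finset (Fin d → ℤ)) :
    ∃ B : ℤ, Set.InjOn (fun ν : Fin d → ℤ => ∑ i, ν i * B ^ (i : ℕ)) S := by
  classical
  -- The weight of `ν` is the value of `q ν` at `B`, so any `B` avoiding the roots of the nonzero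
  -- polynomials `q (ν - μ)` separates the set.
  let q : (Fin d → ℤ) → ℤ[X] := fun ν => ∑ i, C (ν i) * X ^ (i : ℕ)
  have hq : ∀ ν, q ν = 0 → ν = 0 := by
    intro ν h
    funext i
    have := congrArg (fun r => r.coeff i) h
    simpa [q, finsetSum_coeff, coeff_C_mul, coeff_X_pow, Fin.val_inj] using this
  have heval : ∀ ν B, (q ν).eval B = ∑ i, ν i * B ^ (i : ℕ) := by
    intro ν B
    simp [q, eval_finsetSum]
  let Q : ℤ[X] := ∏ x ∈ S.offDiag, q (x.1 - x.2)
  have hQ : Q ≠ 0 := by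
    refine Finset.prod_ne_zero_iff.2 fun x hx h => ?_
    exact (Finset.mem_offDiag.1 hx).2.2 (sub_eq_zero.1 (hq _ h))
  obtain ⟨B, hB⟩ : ∃ B : ℤ, Q.eval B ≠ 0 := by
    by_contra! h
    exact hQ (Polynomial.funext fun r => by simpa using h r)
  simp only [Q, eval_prod, Finset.prod_ne_zero_iff] at hB
  refine ⟨B, fun ν hν μ hμ h => ?_⟩
  by_contra hne
  refine hB (ν, μ) (Finset.mem_offDiag.2 ⟨hν, hμ, hne⟩) ?_
  rw [heval]
  simp only [Pi.sub_apply, sub_mul, Finset.sum_sub_distrib]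
  exact sub_eq_zero.2 h

/-- A Laurent polynomial over an algebraically closed nonarchimedean field without zeros on the
torus has a unique coefficient of maximal norm. -/
theorem exists_dominant_laurent_coeff [IsAlgClosed E] {d : ℕ} (F : Laurent E d)
    (hF : ∀ z : Fin d → E, (∀ i, ‖z i‖ = 1) → F.eval z ≠ 0) :
    ∃ ν, ∀ μ, μ ≠ ν → ‖F.coeff μ‖ < ‖F.coeff ν‖ := by
  classical
  obtain ⟨B, hB⟩ := exists_injOn_weight F.coeff.support
  set w : (Fin d → ℤ) → ℤ := fun ν => ∑ i, ν i * B ^ (i : ℕ) with hw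
  obtain ⟨M, hM⟩ : ∃ M : ℤ, ∀ ν ∈ F.coeff.support, 0 ≤ M + w ν := by
    refine ⟨∑ ν ∈ F.coeff.support, |w ν|, fun ν hν => ?_⟩
    have h1 := Finset.single_le_sum (f := fun ν => |w ν|) (fun _ _ => abs_nonneg _) hν
    have h2 := neg_abs_le (w ν)
    linarith
  let e : (Fin d → ℤ) → ℕ := fun ν => (M + w ν).toNat
  have he : ∀ ν ∈ F.coeff.support, ((e ν : ℕ) : ℤ) = M + w ν := fun ν hν =>
    Int.toNat_of_nonneg (hM ν hν)
  have hinj : Set.InjOn e F.coeff.support := fun ν hν μ hμ h => by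
    refine hB hν hμ ?_
    have h' := congrArg (Nat.cast : ℕ → ℤ) h
    rw [he ν hν, he μ hμ] at h'
    exact add_left_cancel h'
  -- `P` is the restriction of `F` to the curve `z i = u ^ (B ^ i)`, times `u ^ M` to clear negative
  -- exponents. The curve meets the torus where `‖u‖ = 1`, and injectivity of `e` keeps the
  -- coefficients of `F` separate.
  let P : E[X] := ∑ ν ∈ F.coeff.support, monomial (e ν) (F.coeff ν)
  have hcoeff : ∀ ν ∈ F.coeff.support, P.coeff (e ν) = F.coeff ν := by
    intro ν hν
    simp only [P, finsetSum_coeff, coeff_monomial]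
    rw [Finset.sum_eq_single ν]
    · simp
    · intro μ hμ hne
      rw [if_neg fun h => hne (hinj hμ hν h)]
    · exact fun h => absurd hν h
  have heval : ∀ u : E, u ≠ 0 → P.eval u = u ^ M * F.eval fun i => u ^ (B ^ (i : ℕ)) := by
    intro u hu
    simp only [P, eval_finsetSum, eval_monomial, Laurent.eval, Finsupp.sum, Finset.mul_sum]
    refine Finset.sum_congr rfl fun ν hν => ?_
    have hprod : ∀ T : Finset (Fin d), ∏ i ∈ T, (u ^ (B ^ (i : ℕ))) ^ ν i =
        u ^ ∑ i ∈ T, ν i * B ^ (i : ℕ) := by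
      intro T
      induction T using Finset.induction_on with
      | empty => simp
      | insert a T ha ih =>
        rw [Finset.prod_insert ha, Finset.sum_insert ha, zpow_add₀ hu, ih, ← zpow_mul, mul_comm (ν a)]
    rw [hprod, ← zpow_natCast, he ν hν, zpow_add₀ hu]
    ring
  have hne : F.coeff.support.Nonempty := by
    rw [Finset.nonempty_iff_ne_empty]
    intro h
    refine hF (fun _ => 1) (fun _ => norm_one) ?_
    simp [Laurent.eval, Finsupp.sum, h]
  have hP : P ≠ 0 := by
    obtain ⟨ν, hν⟩ := hne
    intro h
    have := hcoeff ν hν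
    rw [h, coeff_zero] at this
    exact Finsupp.mem_support_iff.1 hν this.symm
  obtain ⟨m, hm⟩ := exists_dominant_coeff hP fun u hu hu1 => by
    have hu0 : u ≠ 0 := norm_ne_zero_iff.1 (by rw [hu1]; exact one_ne_zero)
    have h := heval u hu0
    rw [hu.eq_zero] at h
    refine hF (fun i => u ^ (B ^ (i : ℕ))) (fun i => by rw [norm_zpow, hu1, one_zpow]) ?_
    exact (mul_eq_zero.1 h.symm).resolve_left (zpow_ne_zero _ hu0)
  have hm0 : P.coeff m ≠ 0 :=
    norm_ne_zero_iff.1 ((norm_nonneg _).trans_lt (hm (m + 1) (by omega))).ne'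
  obtain ⟨ν, hν, rfl⟩ : ∃ ν ∈ F.coeff.support, e ν = m := by
    by_contra! h
    refine hm0 ?_
    simp only [P, finsetSum_coeff, coeff_monomial]
    exact Finset.sum_eq_zero fun ν hν => if_neg (h ν hν)
  refine ⟨ν, fun μ hμ => ?_⟩
  by_cases hs : μ ∈ F.coeff.support
  · have := hm (e μ) fun h => hμ (hinj hs hν h)
    rwa [hcoeff μ hs, hcoeff ν hν] at this
  · rw [Finsupp.notMem_support_iff.1 hs, norm_zero]
    exact norm_pos_iff.2 (Finsupp.mem_support_iff.1 hν)

end DominantCoefficient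

/-! ### Values of Laurent polynomials and their norms on the torus. -/

namespace Laurent

variable {F : Type*} [Field F] {d : ℕ}

theorem eval_zero (z : Fin d → F) : (0 : Laurent F d).eval z = 0 := by
  simp [eval]

theorem eval_add (z : Fin d → F) (f g : Laurent F d) :
    (f + g).eval z = f.eval z + g.eval z := by
  simp only [eval, AddMonoidAlgebra.coeff_add]
  exact Finsupp.sum_add_index' (by simp) (by intros; ring)

theorem eval_single (z : Fin d → F) (ν : Fin d → ℤ) (a : F) :
    eval z (AddMonoidAlgebra.single ν a) = a * ∏ i, z i ^ ν i := by
  simp [eval]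

theorem eval_mul {z : Fin d → F} (hz : ∀ i, z i ≠ 0) (f g : Laurent F d) :
    (f * g).eval z = f.eval z * g.eval z := by
  have h := eval_eq_evalHom (fun i => Units.mk0 (z i) (hz i))
  simp only [Units.val_mk0] at h
  rw [h, h, h, map_mul]

theorem eval_pow {z : Fin d → F} (hz : ∀ i, z i ≠ 0) (f : Laurent F d) (k : ℕ) :
    (f ^ k).eval z = f.eval z ^ k := by
  have h := eval_eq_evalHom (fun i => Units.mk0 (z i) (hz i))
  simp only [Units.val_mk0] at h
  rw [h, h, map_pow]

theorem norm_eval_le {E : Type*} [NormedField E] [IsUltrametricDist E] {z : Fin d → E}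
    (hz : ∀ i, ‖z i‖ = 1) {f : Laurent E d} {r : ℝ} (hr : 0 ≤ r) (hf : ∀ ν, ‖f.coeff ν‖ ≤ r) :
    ‖f.eval z‖ ≤ r := by
  refine IsUltrametricDist.norm_sum_le_of_forall_le_of_nonneg hr fun ν _ => ?_
  simpa [norm_prod, norm_zpow, hz] using hf ν

end Laurent

/-! ### Averages over `μ_N^d`. -/

section RootsOfUnity

variable {p : ℕ} [Fact p.Prime] {d N : ℕ}

theorem pos_of_coprime (hN : N.Coprime p) : 0 < N :=
  Nat.pos_of_ne_zero fun h => by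
    subst h
    exact (Fact.out : p.Prime).ne_one ((Nat.coprime_zero_left p).1 hN)

theorem mem_rootsOfUnityPow (hN : 0 < N) {ζ : Fin d → ℂ_[p]} :
    ζ ∈ rootsOfUnityPow p d N ↔ ∀ i, ζ i ^ N = 1 := by
  simp [rootsOfUnityPow, Fintype.mem_piFinset, Polynomial.mem_nthRootsFinset hN]

theorem norm_of_mem_rootsOfUnityPow (hN : 0 < N) {ζ : Fin d → ℂ_[p]}
    (hζ : ζ ∈ rootsOfUnityPow p d N) (i : Fin d) : ‖ζ i‖ = 1 :=
  (pow_eq_one_iff_of_nonneg (norm_nonneg _) hN.ne').1 (by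
    rw [← norm_pow, (mem_rootsOfUnityPow hN).1 hζ i, norm_one])

theorem exists_primitiveRoot (p : ℕ) [Fact p.Prime] (hN : 0 < N) :
    ∃ ω : ℂ_[p], IsPrimitiveRoot ω N := by
  have : NeZero (N : ℂ_[p]) := ⟨by exact_mod_cast hN.ne'⟩
  exact HasEnoughRootsOfUnity.exists_primitiveRoot ℂ_[p] N

theorem card_rootsOfUnityPow (hN : 0 < N) : (rootsOfUnityPow p d N).card = N ^ d := by
  obtain ⟨ω, hω⟩ := exists_primitiveRoot p hN
  simp [rootsOfUnityPow, hω.card_nthRootsFinset]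

theorem sum_nthRoots_zpow_eq_zero (hN : 0 < N) {k : ℤ} (hk : ¬ (N : ℤ) ∣ k) :
    ∑ z ∈ Polynomial.nthRootsFinset N (1 : ℂ_[p]), z ^ k = 0 := by
  obtain ⟨ω, hω⟩ := exists_primitiveRoot p hN
  have hω0 : ω ≠ 0 := hω.ne_zero hN.ne'
  have hω1 : ω ^ k ≠ 1 := fun h => hk ((hω.zpow_eq_one_iff_dvd k).1 h)
  have h : ∑ z ∈ Polynomial.nthRootsFinset N (1 : ℂ_[p]), z ^ k =
      ∑ z ∈ Polynomial.nthRootsFinset N (1 : ℂ_[p]), (ω * z) ^ k := by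
    refine (Finset.sum_bij' (fun z _ => ω * z) (fun z _ => ω⁻¹ * z) ?_ ?_ ?_ ?_ ?_).symm
    · intro z hz
      rw [Polynomial.mem_nthRootsFinset hN] at hz ⊢
      rw [mul_pow, hz, hω.pow_eq_one, one_mul]
    · intro z hz
      rw [Polynomial.mem_nthRootsFinset hN] at hz ⊢
      rw [mul_pow, hz, inv_pow, hω.pow_eq_one, inv_one, one_mul]
    · intro z _
      exact inv_mul_cancel_left₀ hω0 z
    · intro z _
      exact mul_inv_cancel_left₀ hω0 z
    · intro z _
      rfl
  simp only [mul_zpow, ← Finset.mul_sum] at h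
  have h' : (1 - ω ^ k) * ∑ z ∈ Polynomial.nthRootsFinset N (1 : ℂ_[p]), z ^ k = 0 := by
    rw [sub_mul, one_mul, ← h, sub_self]
  exact (mul_eq_zero.1 h').resolve_left (sub_ne_zero.2 hω1.symm)

/-- The average of the values of a Laurent polynomial on `μ_N^d`. -/
def rootAverage (N : ℕ) (H : Laurent ℂ_[p] d) : ℂ_[p] :=
  ((N : ℂ_[p]) ^ d)⁻¹ * ∑ ζ ∈ rootsOfUnityPow p d N, H.eval ζ

/-- Coprimality enters here: `N` has norm one, so dividing by `N ^ d` does not enlarge the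
ultrametric bound. -/
theorem norm_average_le (hN : N.Coprime p) {g : (Fin d → ℂ_[p]) → ℂ_[p]} {r : ℝ} (hr : 0 ≤ r)
    (h : ∀ ζ ∈ rootsOfUnityPow p d N, ‖g ζ‖ ≤ r) :
    ‖((N : ℂ_[p]) ^ d)⁻¹ * ∑ ζ ∈ rootsOfUnityPow p d N, g ζ‖ ≤ r := by
  rw [norm_mul, norm_inv, norm_pow, norm_natCast_of_coprime p hN, one_pow, inv_one, one_mul]
  exact IsUltrametricDist.norm_sum_le_of_forall_le_of_nonneg hr h

theorem eventually_coprime (p : ℕ) : ∀ᶠ N in atTopCoprime p, N.Coprime p :=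
  eventually_inf_principal.2 (.of_forall fun _ h => h)

theorem average_const (hN : 0 < N) (a : ℂ_[p]) :
    ((N : ℂ_[p]) ^ d)⁻¹ * ∑ _ζ ∈ rootsOfUnityPow p d N, a = a := by
  have : (N : ℂ_[p]) ≠ 0 := by exact_mod_cast hN.ne'
  rw [Finset.sum_const, card_rootsOfUnityPow hN, nsmul_eq_mul, Nat.cast_pow,
    inv_mul_cancel_left₀ (pow_ne_zero d this)]

/-- By orthogonality a monomial `t^ν` with `ν ≠ 0` averages to zero once `N` exceeds the absolute
value of some nonzero `ν i`. -/
theorem tendsto_rootAverage (H : Laurent ℂ_[p] d) :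
    Tendsto (fun N => rootAverage N H) (atTopCoprime p) (𝓝 (H.coeff 0)) := by
  induction H using AddMonoidAlgebra.induction_linear with
  | zero => simpa [rootAverage, Laurent.eval_zero] using tendsto_const_nhds
  | add x y hx hy =>
    simpa [rootAverage, Laurent.eval_add, Finset.sum_add_distrib, mul_add] using hx.add hy
  | single ν a =>
    refine tendsto_const_nhds.congr' ?_
    by_cases hν : ν = 0
    · subst hν
      filter_upwards [eventually_coprime p] with N hN
      simp only [rootAverage, Laurent.eval_single, Pi.zero_apply, zpow_zero, Finset.prod_const_one,
        mul_one, average_const (pos_of_coprime hN), AddMonoidAlgebra.coeff_single,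
        Finsupp.single_eq_same]
    · obtain ⟨i, hi⟩ := Function.ne_iff.1 hν
      have hbig : ∀ᶠ N in atTopCoprime p, (ν i).natAbs < N :=
        (eventually_gt_atTop _).filter_mono inf_le_left
      filter_upwards [eventually_coprime p, hbig] with N hN hlt
      have hdvd : ¬ (N : ℤ) ∣ ν i := fun h => by
        have := Nat.le_of_dvd (Int.natAbs_pos.2 hi) (Int.natCast_dvd.1 h)
        omega
      simp only [rootAverage, Laurent.eval_single, ← Finset.mul_sum, rootsOfUnityPow]
      rw [← Finset.prod_univ_sum (fun _ : Fin d => Polynomial.nthRootsFinset N (1 : ℂ_[p]))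
        (fun i z => z ^ ν i), Finset.prod_eq_zero (Finset.mem_univ i)
        (sum_nthRoots_zpow_eq_zero (pos_of_coprime hN) hdvd)]
      simp [hν]

/-- The averages of `log (1 + G)` over `μ_N^d` converge if all coefficients of `G` are small. -/
theorem tendsto_average_logSeries {G : Laurent ℂ_[p] d} {r : ℝ} (hr0 : 0 ≤ r) (hr1 : r < 1)
    (hG : ∀ ν, ‖G.coeff ν‖ ≤ r) :
    Tendsto (fun N : ℕ => ((N : ℂ_[p]) ^ d)⁻¹ *
      ∑ ζ ∈ rootsOfUnityPow p d N, logSeries p (G.eval ζ)) (atTopCoprime p)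
      (𝓝 (∑' k : ℕ, (-1) ^ k * (G ^ (k + 1)).coeff 0 / ((k + 1 : ℕ) : ℂ_[p]))) := by
  have hsum := summable_succ_mul_pow_succ hr0 hr1
  have hT : Tendsto (fun N : ℕ => ∑' k : ℕ, (-1) ^ k * rootAverage N (G ^ (k + 1)) /
      ((k + 1 : ℕ) : ℂ_[p])) (atTopCoprime p)
      (𝓝 (∑' k : ℕ, (-1) ^ k * (G ^ (k + 1)).coeff 0 / ((k + 1 : ℕ) : ℂ_[p]))) := by
    -- The bound `(k + 1) * r ^ (k + 1)` on the `k`-th term does not depend on `N`.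
    refine tendsto_tsum_of_dominated_convergence hsum
      (fun k => ((tendsto_rootAverage _).const_mul _).div_const _) ?_
    filter_upwards [eventually_coprime p] with N hN k
    refine norm_div_succ_le ?_ k
    rw [norm_mul, norm_pow, norm_neg, norm_one, one_pow, one_mul]
    refine norm_average_le hN (pow_nonneg hr0 _) fun ζ hζ => ?_
    have h1 := norm_of_mem_rootsOfUnityPow (pos_of_coprime hN) hζ
    rw [Laurent.eval_pow (fun i => norm_ne_zero_iff.1 (by simp [h1 i])), norm_pow]
    exact pow_le_pow_left₀ (norm_nonneg _) (Laurent.norm_eval_le h1 hr0 hG) _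
  refine hT.congr' ?_
  filter_upwards [eventually_coprime p] with N hN
  have hnorm : ∀ ζ ∈ rootsOfUnityPow p d N, ∀ i, ‖ζ i‖ = 1 := fun ζ hζ =>
    norm_of_mem_rootsOfUnityPow (pos_of_coprime hN) hζ
  simp only [logSeries]
  rw [← Summable.tsum_finsetSum, ← tsum_mul_left]
  · refine tsum_congr fun k => ?_
    rw [rootAverage, mul_left_comm, Finset.mul_sum, mul_div_assoc, Finset.sum_div]
    congr 1
    refine Finset.sum_congr rfl fun ζ hζ => ?_
    rw [Laurent.eval_pow (fun i => norm_ne_zero_iff.1 (by simp [hnorm ζ hζ i]))]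
  · intro ζ hζ
    refine Summable.of_norm_bounded hsum fun k => ?_
    exact norm_mul_pow_div_le (by simp) (Laurent.norm_eval_le (hnorm ζ hζ) hr0 hG) k

end RootsOfUnity

/-! ### Existence of the `p`-adic Mahler measure. -/

section MahlerMeasure

variable {p : ℕ} [Fact p.Prime] {d : ℕ}

/-- A Laurent polynomial over `ℤ` without zeros on the `p`-adic torus is `c t^ν (1 + G)`, where
`c` is a nonzero integer and all coefficients of `G` are small. -/
theorem exists_eq_single_mul_one_add (F : Laurent ℤ d)
    (hF : ∀ z ∈ padicTorus p d, (Laurent.mapCoeff d (Int.castRingHom ℂ_[p]) F).eval z ≠ 0) :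
    ∃ (c : ℤ) (ν : Fin d → ℤ) (G : Laurent ℂ_[p] d) (r : ℝ), c ≠ 0 ∧ 0 ≤ r ∧ r < 1 ∧
      (∀ μ, ‖G.coeff μ‖ ≤ r) ∧
      Laurent.mapCoeff d (Int.castRingHom ℂ_[p]) F =
        AddMonoidAlgebra.single ν (c : ℂ_[p]) * (1 + G) := by
  obtain ⟨ν, hν⟩ := exists_dominant_laurent_coeff _ hF
  set F' := Laurent.mapCoeff d (Int.castRingHom ℂ_[p]) F with hF'
  have hcoeff : ∀ μ, F'.coeff μ = (F.coeff μ : ℂ_[p]) := fun μ => by simp [hF']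
  have hc : (F.coeff ν : ℂ_[p]) ≠ 0 := by
    intro h0
    refine hF (fun _ => 1) (fun _ => norm_one) ?_
    have : F' = 0 := by
      ext μ
      by_contra hμ
      have hne : μ ≠ ν := fun h => hμ (by rw [h, hcoeff, h0]; rfl)
      have := hν μ hne
      rw [hcoeff ν, h0, norm_zero] at this
      exact (norm_nonneg _).not_gt this
    rw [this, Laurent.eval_zero]
  -- Dividing by the dominant term makes the constant coefficient `1` and all others of norm less
  -- than `1`. The support is finite, so the maximum `r` of the norms is still less than `1`.
  let G : Laurent ℂ_[p] d := AddMonoidAlgebra.single (-ν) (F.coeff ν : ℂ_[p])⁻¹ * F' - 1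
  have hG : ∀ μ, ‖G.coeff μ‖ < 1 := by
    intro μ
    have h1 : G.coeff μ = (F.coeff ν : ℂ_[p])⁻¹ * F'.coeff (ν + μ) -
        (1 : Laurent ℂ_[p] d).coeff μ := by
      simp only [G, AddMonoidAlgebra.coeff_sub, Finsupp.sub_apply,
        AddMonoidAlgebra.coeff_single_mul_apply, neg_neg]
    rw [h1, AddMonoidAlgebra.one_def, AddMonoidAlgebra.coeff_single, Finsupp.single_apply]
    split_ifs with h
    · subst h
      rw [add_zero, hcoeff, inv_mul_cancel₀ hc, sub_self, norm_zero]
      exact one_pos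
    · rw [sub_zero, norm_mul, norm_inv, ← div_eq_inv_mul, div_lt_one (norm_pos_iff.2 hc), ← hcoeff]
      exact hν _ fun h' => h (by simpa using h' : μ = 0).symm
  refine ⟨F.coeff ν, ν, G, (G.coeff.support.sup fun μ => ‖G.coeff μ‖₊ : NNReal), ?_,
    NNReal.coe_nonneg _, ?_, fun μ => ?_, ?_⟩
  · exact fun h => hc (by rw [h, Int.cast_zero])
  · rw [← NNReal.coe_one, NNReal.coe_lt_coe, Finset.sup_lt_iff one_pos]
    exact fun μ _ => hG μ
  · by_cases hμ : μ ∈ G.coeff.support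
    · exact_mod_cast Finset.le_sup (f := fun μ => ‖G.coeff μ‖₊) hμ
    · rw [Finsupp.notMem_support_iff.1 hμ, norm_zero]
      exact NNReal.coe_nonneg _
  · rw [show (1 : Laurent ℂ_[p] d) + G =
      AddMonoidAlgebra.single (-ν) (F.coeff ν : ℂ_[p])⁻¹ * F' by simp [G], ← mul_assoc,
      AddMonoidAlgebra.single_mul_single, add_neg_cancel, mul_inv_cancel₀ hc,
      ← AddMonoidAlgebra.one_def, one_mul]

/-- The value at `ζ` is an integer times a root of unity times a principal unit, with logarithm `log
c + log(1 + G(ζ))`. The `HasLog` clause later turns the sum of logarithms into the logarithm of a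
product. -/
theorem hasLog_and_exists_mahlerMeasure (F : Laurent ℤ d)
    (hF : ∀ z ∈ padicTorus p d, (Laurent.mapCoeff d (Int.castRingHom ℂ_[p]) F).eval z ≠ 0) :
    (∀ N : ℕ, N.Coprime p → ∀ ζ ∈ rootsOfUnityPow p d N,
      HasLog ((Laurent.mapCoeff d (Int.castRingHom ℂ_[p]) F).eval ζ)) ∧
    ∃ m, HasPadicMahlerMeasure p (Laurent.mapCoeff d (Int.castRingHom ℂ_[p]) F) m := by
  obtain ⟨c, ν, G, r, hc, hr0, hr1, hG, hFG⟩ := exists_eq_single_mul_one_add F hF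
  set F' := Laurent.mapCoeff d (Int.castRingHom ℂ_[p]) F with hF'
  have key : ∀ N : ℕ, N.Coprime p → ∀ ζ ∈ rootsOfUnityPow p d N,
      HasLog (F'.eval ζ) ∧
        padicLog p (F'.eval ζ) = padicLog p (c : ℂ_[p]) + logSeries p (G.eval ζ) := by
    intro N hN ζ hζ
    have hN0 := pos_of_coprime hN
    have h1 := norm_of_mem_rootsOfUnityPow hN0 hζ
    have h0 : ∀ i, ζ i ≠ 0 := fun i => norm_ne_zero_iff.1 (by simp [h1 i])
    have hone : (1 : Laurent ℂ_[p] d).eval ζ = 1 := by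
      simp [AddMonoidAlgebra.one_def, Laurent.eval_single]
    have hroot : (∏ i, ζ i ^ ν i) ^ N = 1 := by
      rw [← Finset.prod_pow]
      refine Finset.prod_eq_one fun i _ => ?_
      rw [← zpow_natCast, ← zpow_mul, mul_comm, zpow_mul, zpow_natCast,
        (mem_rootsOfUnityPow hN0).1 hζ i, one_zpow]
    have hu : ‖1 + G.eval ζ - 1‖ < 1 := by
      rw [add_sub_cancel_left]
      exact (Laurent.norm_eval_le h1 hr0 hG).trans_lt hr1
    have hl1 := (hasLog_intCast (p := p) hc).mul (HasLog.of_pow_eq_one hN0 hroot)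
    have hl2 := HasLog.of_norm_sub_one_lt hu
    rw [hFG, Laurent.eval_mul h0, Laurent.eval_single, Laurent.eval_add, hone]
    refine ⟨hl1.mul hl2, ?_⟩
    rw [padicLog_mul hl1 hl2, padicLog_mul (hasLog_intCast hc) (HasLog.of_pow_eq_one hN0 hroot),
      padicLog_of_pow_eq_one hN0 hroot, add_zero, padicLog_of_norm_sub_one_lt hu,
      add_sub_cancel_left]
  refine ⟨fun N hN ζ hζ => (key N hN ζ hζ).1, _, fun N hN ζ hζ =>
    hF ζ (norm_of_mem_rootsOfUnityPow (pos_of_coprime hN) hζ),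
    ((tendsto_const_nhds (x := padicLog p (c : ℂ_[p]))).add
      (tendsto_average_logSeries hr0 hr1 hG)).congr' ?_⟩
  filter_upwards [eventually_coprime p] with N hN
  rw [Finset.sum_congr rfl fun ζ hζ => (key N hN ζ hζ).2, Finset.sum_add_distrib, mul_add,
    average_const (pos_of_coprime hN)]

end MahlerMeasure

/-! ### The fixed point count as a product of values of the norm polynomial. -/

section NumberField

open NumberField

variable (p : ℕ) [Fact p.Prime] (K : Type*) [Field K] [NumberField K] {d n : ℕ}

theorem finrank_finiteLaurent [NeZero n] :
    Module.finrank ℤ (FiniteLaurent (𝓞 K) d n) = n ^ d * Module.finrank ℚ K := by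
  rw [((AddMonoidAlgebra.coeffLinearEquiv ℤ).trans
      (Finsupp.linearEquivFunOnFinite ℤ (𝓞 K) (Fin d → ZMod n))).finrank_eq,
    Module.finrank_pi_fintype]
  simp [RingOfIntegers.rank, ZMod.card]

theorem comp_algebraMap_injective {F : Type*} [Field F] :
    Function.Injective fun τ : K →+* F => τ.comp (algebraMap (𝓞 K) K) := fun _ _ h =>
  IsLocalization.ringHom_ext (nonZeroDivisors (𝓞 K)) h

variable {K}

theorem eval_laurentNorm (ι : AlgebraicClosure ℚ →+* ℂ_[p]) (z : Fin d → ℂ_[p]ˣ)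
    (g : Laurent (𝓞 K) d) :
    (Laurent.mapCoeff d (Int.castRingHom ℂ_[p]) (laurentNorm K g)).eval
        (fun i => (z i : ℂ_[p])) =
      ∏ τ : K →+* AlgebraicClosure ℚ,
        Laurent.evalHom ((ι.comp τ).comp (algebraMap (𝓞 K) K)) z g := by
  have h := congrArg (Laurent.evalHom ι z) (laurentNorm_spec K g)
  rw [Laurent.evalHom_mapCoeff, map_prod] at h
  simp only [Laurent.evalHom_mapCoeff] at h
  rw [Laurent.eval_eq_evalHom, Laurent.evalHom_mapCoeff,
    RingHom.ext_int ((RingHom.id ℂ_[p]).comp (Int.castRingHom ℂ_[p]))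
      (ι.comp (Int.castRingHom (AlgebraicClosure ℚ))), h]
  rfl

/-- The norm from `𝓞_K[(ℤ/n)^d]` to `ℤ` of the reduction of `g` is the product of the values of
`N_{K/ℚ}(g)` on `μ_n^d`. -/
theorem norm_reduction_eq_prod (hn : 0 < n) [NeZero n] (g : Laurent (𝓞 K) d) :
    ((Algebra.norm ℤ (reduction (𝓞 K) d n g) : ℤ) : ℂ_[p]) =
      ∏ ζ ∈ rootsOfUnityPow p d n,
        (Laurent.mapCoeff d (Int.castRingHom ℂ_[p]) (laurentNorm K g)).eval ζ := by
  let _ : Algebra ℚ (AlgebraicClosure ℚ) := AlgebraicClosure.instAlgebra ℚ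
  have : Algebra.IsAlgebraic ℚ (AlgebraicClosure ℚ) := AlgebraicClosure.isAlgebraic ℚ
  let ι : AlgebraicClosure ℚ →+* ℂ_[p] :=
    (IsAlgClosed.lift (R := ℚ) (S := AlgebraicClosure ℚ) (M := ℂ_[p])).toRingHom
  have hpow : ∀ ζ : rootsOfUnityPow p d n, ∀ i, (ζ : Fin d → ℂ_[p]) i ^ n = 1 := fun ζ =>
    (mem_rootsOfUnityPow hn).1 ζ.2
  let σ : (K →+* AlgebraicClosure ℚ) → (𝓞 K →+* ℂ_[p]) := fun τ =>
    (ι.comp τ).comp (algebraMap (𝓞 K) K)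
  have hσ : Function.Injective σ := (comp_algebraMap_injective K).comp fun τ τ' h =>
    RingHom.ext fun x => ι.injective (DFunLike.congr_fun h x)
  -- Pairs of an embedding and a point of `μ_n^d` give `[K:ℚ] n^d` distinct homomorphisms, which is
  -- the rank required by `norm_eq_prod_ringHom`.
  let φ : (K →+* AlgebraicClosure ℚ) × rootsOfUnityPow p d n →
      (FiniteLaurent (𝓞 K) d n →+* ℂ_[p]) := fun x => evalFinite (σ x.1) x.2 (hpow x.2)
  have hφ : Function.Injective φ := fun x y h => by
    obtain ⟨h1, h2⟩ := evalFinite_injective σ hσ h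
    exact Prod.ext h1 (Subtype.ext h2)
  have hcard : Fintype.card ((K →+* AlgebraicClosure ℚ) × rootsOfUnityPow p d n) =
      Module.finrank ℤ (FiniteLaurent (𝓞 K) d n) := by
    rw [Fintype.card_prod, Embeddings.card, Fintype.card_coe, card_rootsOfUnityPow hn,
      finrank_finiteLaurent, mul_comm]
  refine (norm_eq_prod_ringHom φ hφ hcard _).trans ?_
  rw [Fintype.prod_prod_type_right, ← Finset.prod_coe_sort (rootsOfUnityPow p d n) fun ζ =>
    (Laurent.mapCoeff d (Int.castRingHom ℂ_[p]) (laurentNorm K g)).eval ζ]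
  refine Finset.prod_congr rfl fun ζ _ => ?_
  have h0 : ∀ i, (ζ : Fin d → ℂ_[p]) i ≠ 0 := fun i h => by
    have := hpow ζ i
    rw [h, zero_pow hn.ne'] at this
    exact zero_ne_one this
  have h := eval_laurentNorm p ι (fun i => Units.mk0 _ (h0 i)) g
  simp only [Units.val_mk0] at h
  rw [h]
  exact Finset.prod_congr rfl fun τ _ =>
    evalFinite_reduction (σ τ) (fun i => Units.mk0 _ (h0 i)) (hpow ζ) g

variable {s : ℕ} (f : Matrix (Fin s) (Fin s) (Laurent (𝓞 K) d))

/-- The number of points fixed by `(nℤ)^d` is, up to sign, the product of the values of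
`N_{K/ℚ}(det f)` on `μ_n^d`. -/
theorem finite_fixedSet_and_ncard (hn : 0 < n)
    (h : ∀ ζ ∈ rootsOfUnityPow p d n,
      (Laurent.mapCoeff d (Int.castRingHom ℂ_[p]) (laurentNorm K f.det)).eval ζ ≠ 0) :
    (fixedSet d n (DualSystem f)).Finite ∧
      (((fixedSet d n (DualSystem f)).ncard : ℂ_[p]) = ∏ ζ ∈ rootsOfUnityPow p d n,
          (Laurent.mapCoeff d (Int.castRingHom ℂ_[p]) (laurentNorm K f.det)).eval ζ ∨
        ((fixedSet d n (DualSystem f)).ncard : ℂ_[p]) = -∏ ζ ∈ rootsOfUnityPow p d n,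
          (Laurent.mapCoeff d (Int.castRingHom ℂ_[p]) (laurentNorm K f.det)).eval ζ) := by
  have : NeZero n := ⟨hn.ne'⟩
  have hprod := norm_reduction_eq_prod p hn f.det
  rw [RingHom.map_det] at hprod
  -- Nonvanishing on `μ_n^d` is what makes the cokernel finite.
  have hne : Algebra.norm ℤ ((reduction (𝓞 K) d n).mapMatrix f).det ≠ 0 := by
    intro h0
    rw [h0, Int.cast_zero] at hprod
    exact Finset.prod_ne_zero_iff.2 h hprod.symm
  have hcard : Nat.card (FiniteCoker n f) =
      (Algebra.norm ℤ ((reduction (𝓞 K) d n).mapMatrix f).det).natAbs :=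
    natAbs_norm_det_eq_card _ hne
  have : Finite (FiniteCoker n f) :=
    Nat.finite_of_card_ne_zero (by rw [hcard]; exact Int.natAbs_ne_zero.2 hne)
  refine ⟨finite_fixedSet n f, ?_⟩
  rw [ncard_fixedSet, hcard, ← hprod]
  rcases Int.natAbs_eq (Algebra.norm ℤ ((reduction (𝓞 K) d n).mapMatrix f).det) with h' | h' <;>
    replace h' := congrArg (Int.cast : ℤ → ℂ_[p]) h'
  · rw [Int.cast_natCast] at h'
    exact .inl h'.symm
  · rw [Int.cast_neg, Int.cast_natCast] at h'
    exact .inr (by rw [h', neg_neg])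

end NumberField

end PadicEntropy

end

open NumberField PadicEntropy in
theorem theorem2p4 (p : ℕ) [Fact p.Prime] (d : ℕ) (hd : 0 < d) (s : ℕ)
    (K : Type*) [Field K] [NumberField K]
    (f : Matrix (Fin s) (Fin s) (Laurent (𝓞 K) d))
    (hf : ∀ z ∈ padicTorus p d,
      (Laurent.mapCoeff d (Int.castRingHom ℂ_[p]) (laurentNorm K f.det)).eval z ≠ 0) :
    ∃ h : ℂ_[p],
      HasPadicEntropy p d (DualSystem f) h ∧
      HasPadicMahlerMeasure p
        (Laurent.mapCoeff d (Int.castRingHom ℂ_[p]) (laurentNorm K f.det)) h := by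
  obtain ⟨hlog, m, hm⟩ := hasLog_and_exists_mahlerMeasure (laurentNorm K f.det) hf
  refine ⟨m, ⟨fun n hn => ⟨(finite_fixedSet_and_ncard p f (pos_of_coprime hn) (hm.1 n hn)).1,
    nonempty_fixedSet n f⟩, hm.2.congr' ?_⟩, hm⟩
  filter_upwards [eventually_coprime p] with n hn
  have hl := hlog n hn
  -- The Mahler sum becomes the logarithm of one product, equal to the fixed point count up to a
  -- sign that `padicLog` ignores.
  rw [index_multiples, Nat.cast_pow, ← padicLog_prod _ _ hl]
  rcases (finite_fixedSet_and_ncard p f (pos_of_coprime hn) (hm.1 n hn)).2 with h | h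
  · rw [h]
  · rw [h, padicLog_neg (HasLog.prod _ _ hl)]
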